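/- A prop is a strict symmetric monoidal category whose objects are the natural numbers, with $n\otimes m=n+m$; $\mathsf{PROP}$ is the category of props and identity-on-objects strict symmetric monoidal functors. Write $[n]=\{0,\dots,n-1\}$. Let $\mathsf{PF}$ be the prop whose arrows $n\to m$ are the partial functions $[n]\rightharpoonup[m]$, and $\mathsf{Inj}$ its sub-prop of (total) injective functions, both with disjoint union as monoidal product. Let $\mathsf{Cospan}(\mathsf{PF})$ be the prop of isomorphism classes of cospans in $\mathsf{PF}$, composed by pushout, and $\mathsf{Span}(\mathsf{Inj})$ the prop of isomorphism classes of spans in $\mathsf{Inj}$, composed by pullback. Let $\mathsf{Corel}(\mathsf{PF})$ be the prop of corelations with respect to the costable factorisation system (partial surjections, injections) on $\mathsf{PF}$: its arrows $n\to m$ are the classes of cospans $n\to k\leftarrow m$ in $\mathsf{PF}$ under the equivalence relation generated by relating two cospans when an injection between their apexes commutes with the legs; composition is by pushout. Let $\Gamma:\mathsf{Cospan}(\mathsf{PF})\to\mathsf{Corel}(\mathsf{PF})$ send a cospan to its class. Let $\mathsf{PER}$ be the prop whose arrows $n\to m$ are the partial equivalence relations (symmetric, transitive relations) on $[n]\uplus[m]$.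 The composite of $e_1:n\to z$ and $e_2:z\to m$ is obtained by gluing and restricting, with undefinedness propagating: if $G$ denotes the transitive closure of $e_1\cup e_2$ on $[n]\uplus[z]\uplus[m]$, then $x$ and $y$ in $[n]\uplus[m]$ are related by $e_1;e_2$ iff $x\mathrel{G}y$ and every $w\in[z]$ with $x\mathrel{G}w$ lies in the domain of both $e_1$ and $e_2$ (that is, $w\mathrel{e_1}w$ and $w\mathrel{e_2}w$). The monoidal product is disjoint union, and the identities and symmetries are the partial equivalence relations that identify each element with its image under the identity, respectively under the block permutation. Then: 1. There is an isomorphism of props $\varphi:\mathsf{Corel}(\mathsf{PF})\cong\mathsf{PER}$ sending the class of a cospan $n\xrightarrow{f}k\xleftarrow{g}m$ to the partial equivalence relation that relates $x,y\in[n]\uplus[m]$ iff the copairing $[f,g]$ is defined at $x$ and at $y$ and takes the same value at both. 2. There is a morphism of props $\Pi:\mathsf{Span}(\mathsf{Inj})\to\mathsf{Corel}(\mathsf{PF})$ sending the class of a span to the class of its pushout cospan in $\mathsf{PF}$, and the squares $$\begin{array}{ccc}\mathsf{Inj}+\mathsf{Inj}^{\mathrm{op}}&\longrightarrow&\mathsf{Span}(\mathsf{Inj})\\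 \downarrow&&\downarrow{\scriptstyle\Pi}\\ \mathsf{Cospan}(\mathsf{PF})&\xrightarrow{\ \Gamma\ }&\mathsf{Corel}(\mathsf{PF})\end{array}\qquad\qquad\begin{array}{ccc}\mathsf{Inj}+\mathsf{Inj}^{\mathrm{op}}&\longrightarrow&\mathsf{Span}(\mathsf{Inj})\\ \downarrow&&\downarrow{\scriptstyle\varphi\Pi}\\ \mathsf{Cospan}(\mathsf{PF})&\xrightarrow{\varphi\Gamma}&\mathsf{PER}\end{array}$$ are pushouts in $\mathsf{PROP}$. Here $+$ is the coproduct of props, and the maps out of it are the copairings of the canonical ones: $f\mapsto(\xrightarrow{f}\xleftarrow{\mathrm{id}})$ and $g\mapsto(\xrightarrow{\mathrm{id}}\xleftarrow{g})$ into cospans, $f\mapsto(\xleftarrow{\mathrm{id}}\xrightarrow{f})$ and $g\mapsto(\xleftarrow{g}\xrightarrow{\mathrm{id}})$ into spans. -/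

import Mathlib

open CategoryTheory Limits

/-- The arrow `a ⟶ b` obtained from the identity when `a = b`. -/
def eqArrow {H : ℕ → ℕ → Type} (i : ∀ a, H a a) {a b : ℕ} (h : a = b) : H a b := h ▸ i a

/-- A prop: a strict symmetric monoidal category whose objects are the natural numbers, with
`n ⊗ m = n + m`.  The associators and unitors are identities, i.e. the arrows `eqArrow`. -/
structure PROP where
  Hom : ℕ → ℕ → Type
  id (a : ℕ) : Hom a a
  /-- Composition in diagrammatic order. -/
  comp {a b c : ℕ} : Hom a b → Hom b c → Hom a c
  id_comp {a b : ℕ} (f : Hom a b) : comp (id a) f = f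
  comp_id {a b : ℕ} (f : Hom a b) : comp f (id b) = f
  assoc {a b c d : ℕ} (f : Hom a b) (g : Hom b c) (h : Hom c d) :
    comp (comp f g) h = comp f (comp g h)
  tensor {a b c d : ℕ} : Hom a b → Hom c d → Hom (a + c) (b + d)
  tensor_id (a b : ℕ) : tensor (id a) (id b) = id (a + b)
  tensor_comp {a b c a' b' c' : ℕ} (f : Hom a b) (g : Hom b c) (f' : Hom a' b') (g' : Hom b' c') :
    tensor (comp f g) (comp f' g') = comp (tensor f f') (tensor g g')
  tensor_assoc {a b a' b' a'' b'' : ℕ} (f : Hom a b) (g : Hom a' b') (h : Hom a'' b'') :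
    comp (tensor (tensor f g) h) (eqArrow id (Nat.add_assoc b b' b'')) =
      comp (eqArrow id (Nat.add_assoc a a' a'')) (tensor f (tensor g h))
  unit_tensor {a b : ℕ} (f : Hom a b) :
    comp (tensor (id 0) f) (eqArrow id (Nat.zero_add b)) = comp (eqArrow id (Nat.zero_add a)) f
  tensor_unit {a b : ℕ} (f : Hom a b) :
    comp (tensor f (id 0)) (eqArrow id (Nat.add_zero b)) = comp (eqArrow id (Nat.add_zero a)) f
  symm (a b : ℕ) : Hom (a + b) (b + a)
  symm_natural {a b a' b' : ℕ} (f : Hom a b) (g : Hom a' b') :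
    comp (tensor f g) (symm b b') = comp (symm a a') (tensor g f)
  symm_symm (a b : ℕ) : comp (symm a b) (symm b a) = id (a + b)
  hexagon (a b c : ℕ) :
    comp (comp (eqArrow id (Nat.add_assoc a b c)) (symm a (b + c)))
        (eqArrow id (Nat.add_assoc b c a)) =
      comp (comp (tensor (symm a b) (id c)) (eqArrow id (Nat.add_assoc b a c)))
        (tensor (id b) (symm a c))

namespace PROP

/-- Morphisms of props: identity-on-objects strict symmetric monoidal functors. -/
@[ext] structure Mor (P Q : PROP) where
  map {a b : ℕ} : P.Hom a b → Q.Hom a b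
  map_id (a : ℕ) : map (P.id a) = Q.id a
  map_comp {a b c : ℕ} (f : P.Hom a b) (g : P.Hom b c) :
    map (P.comp f g) = Q.comp (map f) (map g)
  map_tensor {a b c d : ℕ} (f : P.Hom a b) (g : P.Hom c d) :
    map (P.tensor f g) = Q.tensor (map f) (map g)
  map_symm (a b : ℕ) : map (P.symm a b) = Q.symm a b

/-- The category of props. -/
instance : Category PROP where
  Hom := Mor
  id P := ⟨fun f => f, fun _ => rfl, fun _ _ => rfl, fun _ _ => rfl, fun _ _ => rfl⟩
  comp F G :=
    ⟨fun f => G.map (F.map f), fun a => by rw [F.map_id, G.map_id],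
      fun f g => by rw [F.map_comp, G.map_comp], fun f g => by rw [F.map_tensor, G.map_tensor],
      fun a b => by rw [F.map_symm, G.map_symm]⟩

theorem hom_ext {P Q : PROP} {F G : P ⟶ Q}
    (h : ∀ {a b : ℕ} (f : P.Hom a b), F.map f = G.map f) : F = G :=
  Mor.ext (by funext a b f; exact h f)

theorem Mor.map_eqArrow {P Q : PROP} (F : Mor P Q) {a b : ℕ} (h : a = b) :
    F.map (eqArrow P.id h) = eqArrow Q.id h := by
  cases h; exact F.map_id a

/-- The objects of a prop, i.e. the natural numbers, carrying the underlying category. -/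
def Ob (_ : PROP) : Type := ℕ

instance (C : PROP) : Category C.Ob where
  Hom a b := C.Hom a b
  id a := C.id a
  comp f g := C.comp f g
  id_comp := C.id_comp
  comp_id := C.comp_id
  assoc := C.assoc

theorem eqArrow_comp (C : PROP) {a b c : ℕ} (h : a = b) (h' : b = c) :
    C.comp (eqArrow C.id h) (eqArrow C.id h') = eqArrow C.id (h.trans h') := by
  cases h; exact C.id_comp _

/-- Two arrows with equal inverses are equal. -/
theorem eq_of_inv (C : PROP) {a b : ℕ} {l r : C.Hom a b} {l' r' : C.Hom b a}
    (hl : C.comp l l' = C.id a) (hr : C.comp r' r = C.id b) (h : l = r) : l' = r' := by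
  subst h
  calc l' = C.comp (C.comp r' l) l' := by rw [hr, C.id_comp]
    _ = r' := by rw [C.assoc, hl, C.comp_id]

theorem inv_comp (C : PROP) {a b c : ℕ} {f : C.Hom a b} {g : C.Hom b c} {f' : C.Hom b a}
    {g' : C.Hom c b} (hf : C.comp f f' = C.id a) (hg : C.comp g g' = C.id b) :
    C.comp (C.comp f g) (C.comp g' f') = C.id a := by
  rw [C.assoc, ← C.assoc g, hg, C.id_comp, hf]

theorem eqArrow_inv (C : PROP) {a b : ℕ} (h : a = b) :
    C.comp (eqArrow C.id h) (eqArrow C.id h.symm) = C.id a := by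
  rw [eqArrow_comp]; rfl

theorem tensor_inv (C : PROP) {a b c d : ℕ} {f : C.Hom a b} {g : C.Hom c d} {f' : C.Hom b a}
    {g' : C.Hom d c} (hf : C.comp f f' = C.id a) (hg : C.comp g g' = C.id c) :
    C.comp (C.tensor f g) (C.tensor f' g') = C.id (a + c) := by
  rw [← C.tensor_comp, hf, hg, C.tensor_id]

theorem eqArrow_op (C : PROP) {a b : ℕ} (h : a = b) :
    eqArrow (H := fun a b => C.Hom b a) C.id h = eqArrow C.id h.symm := by
  cases h; rfl

theorem swap_eqArrow (C : PROP) {a b c d : ℕ} (h : a = b) (h' : c = d) (f : C.Hom a c)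
    (g : C.Hom b d) (e : C.comp f (eqArrow C.id h') = C.comp (eqArrow C.id h) g) :
    C.comp (eqArrow C.id h.symm) f = C.comp g (eqArrow C.id h'.symm) := by
  cases h; cases h'
  simpa [eqArrow, C.comp_id, C.id_comp] using e

/-- The opposite prop. -/
def op (C : PROP) : PROP where
  Hom a b := C.Hom b a
  id a := C.id a
  comp f g := C.comp g f
  id_comp f := C.comp_id f
  comp_id f := C.id_comp f
  assoc f g h := (C.assoc h g f).symm
  tensor f g := C.tensor f g
  tensor_id := C.tensor_id
  tensor_comp f g f' g' := C.tensor_comp g f g' f'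
  tensor_assoc f g h := by
    rw [eqArrow_op, eqArrow_op]
    exact C.swap_eqArrow _ _ _ _ (C.tensor_assoc f g h)
  unit_tensor f := by
    rw [eqArrow_op, eqArrow_op]
    exact C.swap_eqArrow _ _ _ _ (C.unit_tensor f)
  tensor_unit f := by
    rw [eqArrow_op, eqArrow_op]
    exact C.swap_eqArrow _ _ _ _ (C.tensor_unit f)
  symm a b := C.symm b a
  symm_natural f g := (C.symm_natural g f).symm
  symm_symm a b := C.symm_symm a b
  hexagon a b c := by
    simp only [eqArrow_op]
    refine C.eq_of_inv (C.inv_comp (C.inv_comp (C.eqArrow_inv _) (C.symm_symm _ _))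
      (C.eqArrow_inv _)) ?_ (C.hexagon a b c)
    exact C.inv_comp (C.tensor_inv (C.id_comp _) (C.symm_symm _ _)) (C.inv_comp
      (C.eqArrow_inv (Nat.add_assoc b a c).symm) (C.tensor_inv (C.symm_symm _ _) (C.id_comp _)))

/-- The opposite of a morphism of props. -/
def Mor.op {P Q : PROP} (F : P ⟶ Q) : P.op ⟶ Q.op :=
  Mor.mk (P := P.op) (Q := Q.op) (fun f => F.map f) F.map_id (fun f g => F.map_comp g f)
    (fun f g => F.map_tensor f g) (fun a b => F.map_symm b a)

/-! ### Coproducts of props -/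

/-- Formal expressions built from the arrows of two props. -/
inductive Term (P Q : PROP) : ℕ → ℕ → Type
  | inl {a b : ℕ} (f : P.Hom a b) : Term P Q a b
  | inr {a b : ℕ} (f : Q.Hom a b) : Term P Q a b
  | id (a : ℕ) : Term P Q a a
  | comp {a b c : ℕ} (f : Term P Q a b) (g : Term P Q b c) : Term P Q a c
  | tensor {a b c d : ℕ} (f : Term P Q a b) (g : Term P Q c d) : Term P Q (a + c) (b + d)
  | symm (a b : ℕ) : Term P Q (a + b) (b + a)

/-- The congruence generated by the axioms of props and by the requirement that the two
inclusions be morphisms of props. -/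
inductive TermRel (P Q : PROP) : ∀ {a b : ℕ}, Term P Q a b → Term P Q a b → Prop
  | refl {a b : ℕ} (f : Term P Q a b) : TermRel P Q f f
  | sym {a b : ℕ} {f g : Term P Q a b} : TermRel P Q f g → TermRel P Q g f
  | trans {a b : ℕ} {f g h : Term P Q a b} : TermRel P Q f g → TermRel P Q g h → TermRel P Q f h
  | comp_congr {a b c : ℕ} {f f' : Term P Q a b} {g g' : Term P Q b c} :
      TermRel P Q f f' → TermRel P Q g g' → TermRel P Q (f.comp g) (f'.comp g')
  | tensor_congr {a b c d : ℕ} {f f' : Term P Q a b} {g g' : Term P Q c d} :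
      TermRel P Q f f' → TermRel P Q g g' → TermRel P Q (f.tensor g) (f'.tensor g')
  | id_comp {a b : ℕ} (f : Term P Q a b) : TermRel P Q ((Term.id a).comp f) f
  | comp_id {a b : ℕ} (f : Term P Q a b) : TermRel P Q (f.comp (Term.id b)) f
  | assoc {a b c d : ℕ} (f : Term P Q a b) (g : Term P Q b c) (h : Term P Q c d) :
      TermRel P Q ((f.comp g).comp h) (f.comp (g.comp h))
  | tensor_id (a b : ℕ) : TermRel P Q ((Term.id a).tensor (Term.id b)) (Term.id (a + b))
  | tensor_comp {a b c a' b' c' : ℕ} (f : Term P Q a b) (g : Term P Q b c) (f' : Term P Q a' b')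
      (g' : Term P Q b' c') :
      TermRel P Q ((f.comp g).tensor (f'.comp g')) ((f.tensor f').comp (g.tensor g'))
  | tensor_assoc {a b a' b' a'' b'' : ℕ} (f : Term P Q a b) (g : Term P Q a' b')
      (h : Term P Q a'' b'') :
      TermRel P Q (((f.tensor g).tensor h).comp (eqArrow Term.id (Nat.add_assoc b b' b'')))
        ((eqArrow Term.id (Nat.add_assoc a a' a'')).comp (f.tensor (g.tensor h)))
  | unit_tensor {a b : ℕ} (f : Term P Q a b) :
      TermRel P Q (((Term.id 0).tensor f).comp (eqArrow Term.id (Nat.zero_add b)))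
        ((eqArrow Term.id (Nat.zero_add a)).comp f)
  | tensor_unit {a b : ℕ} (f : Term P Q a b) :
      TermRel P Q ((f.tensor (Term.id 0)).comp (eqArrow Term.id (Nat.add_zero b)))
        ((eqArrow Term.id (Nat.add_zero a)).comp f)
  | symm_natural {a b a' b' : ℕ} (f : Term P Q a b) (g : Term P Q a' b') :
      TermRel P Q ((f.tensor g).comp (Term.symm b b')) ((Term.symm a a').comp (g.tensor f))
  | symm_symm (a b : ℕ) : TermRel P Q ((Term.symm a b).comp (Term.symm b a)) (Term.id (a + b))
  | hexagon (a b c : ℕ) :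
      TermRel P Q
        (((eqArrow Term.id (Nat.add_assoc a b c)).comp (Term.symm a (b + c))).comp
          (eqArrow Term.id (Nat.add_assoc b c a)))
        ((((Term.symm a b).tensor (Term.id c)).comp (eqArrow Term.id (Nat.add_assoc b a c))).comp
          ((Term.id b).tensor (Term.symm a c)))
  | inl_id (a : ℕ) : TermRel P Q (Term.inl (P.id a)) (Term.id a)
  | inl_comp {a b c : ℕ} (f : P.Hom a b) (g : P.Hom b c) :
      TermRel P Q (Term.inl (P.comp f g)) ((Term.inl f).comp (Term.inl g))
  | inl_tensor {a b c d : ℕ} (f : P.Hom a b) (g : P.Hom c d) :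
      TermRel P Q (Term.inl (P.tensor f g)) ((Term.inl f).tensor (Term.inl g))
  | inl_symm (a b : ℕ) : TermRel P Q (Term.inl (P.symm a b)) (Term.symm a b)
  | inr_id (a : ℕ) : TermRel P Q (Term.inr (Q.id a)) (Term.id a)
  | inr_comp {a b c : ℕ} (f : Q.Hom a b) (g : Q.Hom b c) :
      TermRel P Q (Term.inr (Q.comp f g)) ((Term.inr f).comp (Term.inr g))
  | inr_tensor {a b c d : ℕ} (f : Q.Hom a b) (g : Q.Hom c d) :
      TermRel P Q (Term.inr (Q.tensor f g)) ((Term.inr f).tensor (Term.inr g))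
  | inr_symm (a b : ℕ) : TermRel P Q (Term.inr (Q.symm a b)) (Term.symm a b)

theorem mk_eqArrow (P Q : PROP) {a b : ℕ} (h : a = b) :
    eqArrow (H := fun a b => Quot (TermRel P Q (a := a) (b := b))) (fun a => Quot.mk _ (Term.id a)) h
      = Quot.mk _ (eqArrow Term.id h) := by
  cases h; rfl

/-- The coproduct of two props. -/
def sum (P Q : PROP) : PROP where
  Hom a b := Quot (TermRel P Q (a := a) (b := b))
  id a := Quot.mk _ (Term.id a)
  comp := Quot.map₂ Term.comp (fun f _ _ h => .comp_congr (.refl f) h)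
    (fun _ _ g h => .comp_congr h (.refl g))
  id_comp := by rintro a b ⟨f⟩; exact Quot.sound (.id_comp f)
  comp_id := by rintro a b ⟨f⟩; exact Quot.sound (.comp_id f)
  assoc := by rintro a b c d ⟨f⟩ ⟨g⟩ ⟨h⟩; exact Quot.sound (.assoc f g h)
  tensor := Quot.map₂ Term.tensor (fun f _ _ h => .tensor_congr (.refl f) h)
    (fun _ _ g h => .tensor_congr h (.refl g))
  tensor_id a b := Quot.sound (.tensor_id a b)
  tensor_comp := by
    rintro a b c a' b' c' ⟨f⟩ ⟨g⟩ ⟨f'⟩ ⟨g'⟩; exact Quot.sound (.tensor_comp f g f' g')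
  tensor_assoc := by
    rintro a b a' b' a'' b'' ⟨f⟩ ⟨g⟩ ⟨h⟩
    simp only [mk_eqArrow]; exact Quot.sound (.tensor_assoc f g h)
  unit_tensor := by
    rintro a b ⟨f⟩; simp only [mk_eqArrow]; exact Quot.sound (.unit_tensor f)
  tensor_unit := by
    rintro a b ⟨f⟩; simp only [mk_eqArrow]; exact Quot.sound (.tensor_unit f)
  symm a b := Quot.mk _ (Term.symm a b)
  symm_natural := by rintro a b a' b' ⟨f⟩ ⟨g⟩; exact Quot.sound (.symm_natural f g)
  symm_symm a b := Quot.sound (.symm_symm a b)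
  hexagon a b c := by simp only [mk_eqArrow]; exact Quot.sound (.hexagon a b c)

/-- The first inclusion into the coproduct. -/
def sumInl (P Q : PROP) : P ⟶ sum P Q :=
  Mor.mk (P := P) (Q := sum P Q) (fun f => Quot.mk _ (Term.inl f))
    (fun a => Quot.sound (.inl_id a))
    (fun f g => Quot.sound (.inl_comp f g)) (fun f g => Quot.sound (.inl_tensor f g))
    (fun a b => Quot.sound (.inl_symm a b))

/-- The second inclusion into the coproduct. -/
def sumInr (P Q : PROP) : Q ⟶ sum P Q :=
  Mor.mk (P := Q) (Q := sum P Q) (fun f => Quot.mk _ (Term.inr f))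
    (fun a => Quot.sound (.inr_id a))
    (fun f g => Quot.sound (.inr_comp f g)) (fun f g => Quot.sound (.inr_tensor f g))
    (fun a b => Quot.sound (.inr_symm a b))

/-- Interpretation of formal expressions in a third prop. -/
def Term.eval {P Q R : PROP} (F : P ⟶ R) (G : Q ⟶ R) : ∀ {a b : ℕ}, Term P Q a b → R.Hom a b
  | _, _, .inl f => F.map f
  | _, _, .inr f => G.map f
  | _, _, .id a => R.id a
  | _, _, .comp f g => R.comp (f.eval F G) (g.eval F G)
  | _, _, .tensor f g => R.tensor (f.eval F G) (g.eval F G)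
  | _, _, .symm a b => R.symm a b

theorem Term.eval_eqArrow {P Q R : PROP} (F : P ⟶ R) (G : Q ⟶ R) {a b : ℕ} (h : a = b) :
    (eqArrow (Term.id (P := P) (Q := Q)) h).eval F G = eqArrow R.id h := by
  cases h; rfl

theorem TermRel.eval {P Q R : PROP} (F : P ⟶ R) (G : Q ⟶ R) {a b : ℕ} {f g : Term P Q a b}
    (h : TermRel P Q f g) : f.eval F G = g.eval F G := by
  induction h with
  | refl => rfl
  | sym _ ih => exact ih.symm
  | trans _ _ ih ih' => exact ih.trans ih'
  | comp_congr _ _ ih ih' => simp only [Term.eval, ih, ih']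
  | tensor_congr _ _ ih ih' => simp only [Term.eval, ih, ih']
  | id_comp => exact R.id_comp _
  | comp_id => exact R.comp_id _
  | assoc => exact R.assoc _ _ _
  | tensor_id => exact R.tensor_id _ _
  | tensor_comp => exact R.tensor_comp _ _ _ _
  | tensor_assoc => simp only [Term.eval, Term.eval_eqArrow]; exact R.tensor_assoc _ _ _
  | unit_tensor => simp only [Term.eval, Term.eval_eqArrow]; exact R.unit_tensor _
  | tensor_unit => simp only [Term.eval, Term.eval_eqArrow]; exact R.tensor_unit _
  | symm_natural => exact R.symm_natural _ _
  | symm_symm => exact R.symm_symm _ _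
  | hexagon => simp only [Term.eval, Term.eval_eqArrow]; exact R.hexagon _ _ _
  | inl_id => exact F.map_id _
  | inl_comp => exact F.map_comp _ _
  | inl_tensor => exact F.map_tensor _ _
  | inl_symm => exact F.map_symm _ _
  | inr_id => exact G.map_id _
  | inr_comp => exact G.map_comp _ _
  | inr_tensor => exact G.map_tensor _ _
  | inr_symm => exact G.map_symm _ _

/-- The copairing of two morphisms of props. -/
def sumDesc {P Q R : PROP} (F : P ⟶ R) (G : Q ⟶ R) : sum P Q ⟶ R :=
  Mor.mk (P := sum P Q) (Q := R)
    (fun f => Quot.lift (fun t : Term P Q _ _ => t.eval F G) (fun _ _ h => h.eval F G) f)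
    (fun _ => rfl) (by rintro a b c ⟨f⟩ ⟨g⟩; rfl) (by rintro a b c d ⟨f⟩ ⟨g⟩; rfl)
    (fun _ _ => rfl)

theorem sumDesc_unique {P Q R : PROP} {F : P ⟶ R} {G : Q ⟶ R} (K : sum P Q ⟶ R)
    (hF : sumInl P Q ≫ K = F) (hG : sumInr P Q ≫ K = G) : K = sumDesc F G := by
  subst hF hG
  refine hom_ext ?_
  suffices h : ∀ {a b : ℕ} (t : Term P Q a b), K.map (Quot.mk _ t) = t.eval _ _ by
    rintro a b ⟨t⟩; exact h t
  intro a b t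
  induction t with
  | inl f => rfl
  | inr f => rfl
  | id a => exact K.map_id a
  | comp f g ihf ihg => exact (K.map_comp (Quot.mk _ f) (Quot.mk _ g)).trans (by rw [ihf, ihg]; rfl)
  | tensor f g ihf ihg =>
    exact (K.map_tensor (Quot.mk _ f) (Quot.mk _ g)).trans (by rw [ihf, ihg]; rfl)
  | symm a b => exact K.map_symm a b

instance : HasBinaryCoproducts PROP :=
  have (P Q : PROP) : HasColimit (pair P Q) :=
    ⟨⟨⟨BinaryCofan.mk (sumInl P Q) (sumInr P Q),
      BinaryCofan.IsColimit.mk _ (fun F G => sumDesc F G) (fun _ _ => rfl) (fun _ _ => rfl)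
        (fun _ _ K hF hG => sumDesc_unique K hF hG)⟩⟩⟩
  hasBinaryCoproducts_of_hasColimit_pair PROP

end PROP

namespace PROP

/-! ### Cospans, spans and corelations -/

/-- `C` has pushouts, and its monoidal product preserves them. -/
class TensorPushouts (C : PROP) : Prop where
  hasPushouts : HasPushouts C.Ob
  tensor {y n m p y' n' m' p' : ℕ} {f : C.Hom y n} {g : C.Hom y m} {i : C.Hom n p}
    {j : C.Hom m p} {f' : C.Hom y' n'} {g' : C.Hom y' m'} {i' : C.Hom n' p'} {j' : C.Hom m' p'} :
    IsPushout (C := C.Ob) f g i j → IsPushout (C := C.Ob) f' g' i' j' →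
      IsPushout (C := C.Ob) (C.tensor f f') (C.tensor g g') (C.tensor i i') (C.tensor j j')

/-- A class of arrows closed under the monoidal product. -/
class TensorClosed {C : PROP} (M : MorphismProperty C.Ob) : Prop where
  tensor {a b c d : ℕ} {f : C.Hom a b} {g : C.Hom c d} :
    M (X := a) (Y := b) f → M (X := c) (Y := d) g → M (X := a + c) (Y := b + d) (C.tensor f g)

/-- A cospan `a ⟶ apex ⟵ b`. -/
structure Cosp (C : PROP) (a b : ℕ) where
  apex : ℕ
  left : C.Hom a apex
  right : C.Hom b apex

/-- Two cospans are related if there is an arrow in `M` between their apexes that commutes with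
the legs. -/
def CospRel {C : PROP} (M : MorphismProperty C.Ob) {a b : ℕ} (s t : Cosp C a b) : Prop :=
  ∃ m : C.Hom s.apex t.apex, M (X := s.apex) (Y := t.apex) m ∧
    C.comp s.left m = t.left ∧ C.comp s.right m = t.right

/-- Cospans modulo the equivalence relation generated by `CospRel M`. -/
abbrev CospMod {C : PROP} (M : MorphismProperty C.Ob) (a b : ℕ) : Type :=
  Quot (CospRel M (a := a) (b := b))

section CospMod

variable {C : PROP} (M : MorphismProperty C.Ob)

/-- The class of the cospan with legs `f` and `g`. -/
def cmk {a b n : ℕ} (f : C.Hom a n) (g : C.Hom b n) : CospMod M a b := Quot.mk _ ⟨n, f, g⟩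

variable {M} in
theorem cmk_sound {a b n n' : ℕ} {f : C.Hom a n} {g : C.Hom b n} {f' : C.Hom a n'}
    {g' : C.Hom b n'} (m : C.Hom n n') (hm : M (X := n) (Y := n') m) (hf : C.comp f m = f')
    (hg : C.comp g m = g') : cmk M f g = cmk M f' g' :=
  Quot.sound ⟨m, hm, hf, hg⟩

/-- The composite of two cospans, obtained from a pushout. -/
noncomputable def Cosp.comp [TensorPushouts C] {a b c : ℕ} (s : Cosp C a b) (t : Cosp C b c) :
    Cosp C a c :=
  haveI : HasPushouts C.Ob := TensorPushouts.hasPushouts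
  { apex := pushout (C := C.Ob) s.right t.left
    left := C.comp s.left (pushout.inl (C := C.Ob) s.right t.left)
    right := C.comp t.right (pushout.inr (C := C.Ob) s.right t.left) }

theorem exists_pushout [TensorPushouts C] {y n m : ℕ} (f : C.Hom y n) (g : C.Hom y m) :
    ∃ (p : ℕ) (i : C.Hom n p) (j : C.Hom m p), IsPushout (C := C.Ob) f g i j :=
  have : HasPushouts C.Ob := TensorPushouts.hasPushouts
  ⟨_, _, _, IsPushout.of_hasPushout (C := C.Ob) f g⟩

theorem eqArrow_cmk_left {a b : ℕ} (h : a = b) :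
    eqArrow (fun a => cmk M (C.id a) (C.id a)) h = cmk M (eqArrow C.id h) (C.id b) := by
  cases h; rfl

theorem eqArrow_cmk_right {a b : ℕ} (h : a = b) :
    eqArrow (fun a => cmk M (C.id a) (C.id a)) h = cmk M (C.id a) (eqArrow C.id h.symm) := by
  cases h; rfl

theorem cmk_eqArrow {a a' b b' n n' : ℕ} (ha : a = a') (hb : b = b') (hn : n = n')
    (f : C.Hom a n) (f' : C.Hom a' n') (g : C.Hom b n) (g' : C.Hom b' n')
    (hf : C.comp f (eqArrow C.id hn) = C.comp (eqArrow C.id ha) f')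
    (hg : C.comp g (eqArrow C.id hn) = C.comp (eqArrow C.id hb) g') :
    cmk M f (C.comp (eqArrow C.id hb.symm) g) = cmk M (C.comp (eqArrow C.id ha) f') g' := by
  cases ha; cases hb; cases hn
  simp only [eqArrow, C.comp_id, C.id_comp] at *
  rw [hf, hg]

variable [M.ContainsIdentities]

variable {M} in
theorem mem_id (a : ℕ) : M (X := a) (Y := a) (C.id a) := M.id_mem (X := a)

variable [M.IsStableUnderCobaseChange]

variable {M} in
theorem mem_of_inv {a b : ℕ} (f : C.Hom a b) (g : C.Hom b a) (h : C.comp f g = C.id a)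
    (h' : C.comp g f = C.id b) : M (X := a) (Y := b) f :=
  have : IsIso (C := C.Ob) (X := a) (Y := b) f := ⟨g, h, h'⟩
  M.of_isIso (X := a) (Y := b) f

theorem mk_comp [TensorPushouts C] {a b c p : ℕ} (s : Cosp C a b) (t : Cosp C b c)
    {i : C.Hom s.apex p} {j : C.Hom t.apex p} (h : IsPushout (C := C.Ob) s.right t.left i j) :
    (Quot.mk _ (s.comp t) : CospMod M a c) = cmk M (C.comp s.left i) (C.comp t.right j) := by
  have : HasPushouts C.Ob := TensorPushouts.hasPushouts
  have e1 := h.inl_isoPushout_inv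
  have e2 := h.inr_isoPushout_inv
  refine cmk_sound (M := M) h.isoPushout.inv (mem_of_inv h.isoPushout.inv h.isoPushout.hom
    h.isoPushout.inv_hom_id h.isoPushout.hom_inv_id) ?_ ?_
  · exact (C.assoc _ _ _).trans (congrArg (C.comp s.left) e1)
  · exact (C.assoc _ _ _).trans (congrArg (C.comp t.right) e2)

/-- Composition of classes of cospans. -/
noncomputable def ccomp [TensorPushouts C] {a b c : ℕ} :
    CospMod M a b → CospMod M b c → CospMod M a c :=
  Quot.lift₂ (fun s t => Quot.mk _ (s.comp t))
    (by
      rintro s t t' ⟨m, hm, hl, hr⟩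
      obtain ⟨p, i, j, h⟩ := exists_pushout s.right t.left
      obtain ⟨q, k, m', h'⟩ := exists_pushout j m
      have h2 : IsPushout (C := C.Ob) s.right t'.left (C.comp i k) m' := hl ▸ h.paste_vert h'
      rw [mk_comp M s t h, mk_comp M s t' h2]
      refine cmk_sound k (MorphismProperty.IsStableUnderCobaseChange.of_isPushout h' hm)
        (C.assoc _ _ _) ?_
      have e : C.comp j k = C.comp m m' := h'.w
      rw [C.assoc, e, ← hr, C.assoc])
    (by
      rintro s s' t ⟨m, hm, hl, hr⟩
      obtain ⟨p, i, j, h⟩ := exists_pushout s.right t.left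
      obtain ⟨q, k, m', h'⟩ := exists_pushout i m
      have h2 : IsPushout (C := C.Ob) s'.right t.left m' (C.comp j k) :=
        hr ▸ (h.flip.paste_vert h').flip
      rw [mk_comp M s t h, mk_comp M s' t h2]
      refine cmk_sound k (MorphismProperty.IsStableUnderCobaseChange.of_isPushout h' hm)
        ?_ (C.assoc _ _ _)
      have e : C.comp i k = C.comp m m' := h'.w
      rw [C.assoc, e, ← hl, C.assoc])

theorem ccomp_eq [TensorPushouts C] {a b c n n' p : ℕ} (f : C.Hom a n) (g : C.Hom b n)
    (f' : C.Hom b n') (g' : C.Hom c n') {i : C.Hom n p} {j : C.Hom n' p}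
    (h : IsPushout (C := C.Ob) g f' i j) :
    ccomp M (cmk M f g) (cmk M f' g') = cmk M (C.comp f i) (C.comp g' j) :=
  mk_comp M ⟨n, f, g⟩ ⟨n', f', g'⟩ h

theorem ccomp_left [TensorPushouts C] {a b c n : ℕ} (h : C.Hom a b) (f : C.Hom b n)
    (g : C.Hom c n) : ccomp M (cmk M h (C.id b)) (cmk M f g) = cmk M (C.comp h f) g := by
  rw [ccomp_eq M h (C.id b) f g (IsPushout.id_horiz (C := C.Ob) f)]
  exact congrArg _ (C.comp_id g)

theorem ccomp_right [TensorPushouts C] {a b c n : ℕ} (f : C.Hom a n) (g : C.Hom b n)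
    (h : C.Hom c b) : ccomp M (cmk M f g) (cmk M (C.id b) h) = cmk M f (C.comp h g) := by
  rw [ccomp_eq M f g (C.id b) h (IsPushout.id_vert (C := C.Ob) g)]
  exact congrArg (fun x => cmk M x _) (C.comp_id f)

/-- Monoidal product of classes of cospans. -/
def ctensor [TensorClosed M] {a b c d : ℕ} :
    CospMod M a b → CospMod M c d → CospMod M (a + c) (b + d) :=
  Quot.lift₂ (fun s t => cmk M (C.tensor s.left t.left) (C.tensor s.right t.right))
    (by
      rintro s t t' ⟨m, hm, hl, hr⟩
      refine cmk_sound (C.tensor (C.id _) m) (TensorClosed.tensor (mem_id _) hm) ?_ ?_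
      · rw [← C.tensor_comp, C.comp_id, hl]
      · rw [← C.tensor_comp, C.comp_id, hr])
    (by
      rintro s s' t ⟨m, hm, hl, hr⟩
      refine cmk_sound (C.tensor m (C.id _)) (TensorClosed.tensor hm (mem_id _)) ?_ ?_
      · rw [← C.tensor_comp, C.comp_id, hl]
      · rw [← C.tensor_comp, C.comp_id, hr])

theorem cmk_symm (a b : ℕ) :
    cmk M (C.symm a b) (C.id (b + a)) = cmk M (C.id (a + b)) (C.symm b a) :=
  cmk_sound (C.symm b a) (mem_of_inv _ _ (C.symm_symm b a) (C.symm_symm a b))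
    (C.symm_symm a b) (C.id_comp _)

/-- The prop of cospans in `C` modulo the equivalence relation generated by `CospRel M`, with
composition by pushout and with monoidal product and symmetries inherited from `C`. -/
noncomputable def cospMod [TensorPushouts C] [TensorClosed M] : PROP where
  Hom a b := CospMod M a b
  id a := cmk M (C.id a) (C.id a)
  comp := ccomp M
  id_comp := by
    rintro a b ⟨s⟩
    exact (ccomp_left M _ s.left s.right).trans (by rw [C.id_comp]; rfl)
  comp_id := by
    rintro a b ⟨s⟩
    exact (ccomp_right M s.left s.right _).trans (by rw [C.id_comp]; rfl)
  assoc := by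
    rintro a b c d ⟨⟨n, f, g⟩⟩ ⟨⟨n', f', g'⟩⟩ ⟨⟨n'', f'', g''⟩⟩
    obtain ⟨p, i, j, h⟩ := exists_pushout g f'
    obtain ⟨q, k, l, h'⟩ := exists_pushout g' f''
    obtain ⟨r, u, v, h''⟩ := exists_pushout j k
    change ccomp M (ccomp M (cmk M f g) (cmk M f' g')) (cmk M f'' g'') =
      ccomp M (cmk M f g) (ccomp M (cmk M f' g') (cmk M f'' g''))
    have h1 : IsPushout (C := C.Ob) (C.comp g' j) f'' u (C.comp l v) :=
      (h'.flip.paste_vert h''.flip).flip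
    have h2 : IsPushout (C := C.Ob) g (C.comp f' k) (C.comp i u) v := h.paste_vert h''
    rw [ccomp_eq M f g f' g' h, ccomp_eq M f' g' f'' g'' h',
      ccomp_eq M (C.comp f i) (C.comp g' j) f'' g'' h1,
      ccomp_eq M f g (C.comp f' k) (C.comp g'' l) h2, C.assoc, C.assoc]
  tensor := ctensor M
  tensor_id a b := by
    change cmk M (C.tensor _ _) (C.tensor _ _) = _
    rw [C.tensor_id]
  tensor_comp := by
    rintro a b c a' b' c' ⟨⟨n, f, g⟩⟩ ⟨⟨m, h, k⟩⟩ ⟨⟨n', f', g'⟩⟩ ⟨⟨m', h', k'⟩⟩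
    obtain ⟨p, i, j, e⟩ := exists_pushout g h
    obtain ⟨p', i', j', e'⟩ := exists_pushout g' h'
    change ctensor M (ccomp M (cmk M f g) (cmk M h k)) (ccomp M (cmk M f' g') (cmk M h' k')) =
      ccomp M (cmk M (C.tensor f f') (C.tensor g g')) (cmk M (C.tensor h h') (C.tensor k k'))
    rw [ccomp_eq M f g h k e, ccomp_eq M f' g' h' k' e',
      ccomp_eq M _ _ _ _ (TensorPushouts.tensor e e'), ← C.tensor_comp, ← C.tensor_comp]
    rfl
  tensor_assoc := by
    rintro a b a' b' a'' b'' ⟨⟨n, f, g⟩⟩ ⟨⟨n', f', g'⟩⟩ ⟨⟨n'', f'', g''⟩⟩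
    refine (congrArg (ccomp M _) (eqArrow_cmk_right M _)).trans ((ccomp_right M _ _ _).trans
      (Eq.trans ?_ ((congrArg (fun x => ccomp M x _) (eqArrow_cmk_left M _)).trans
        (ccomp_left M _ _ _)).symm))
    exact cmk_eqArrow M _ _ _ _ _ _ _ (C.tensor_assoc f f' f'') (C.tensor_assoc g g' g'')
  unit_tensor := by
    rintro a b ⟨⟨n, f, g⟩⟩
    refine (congrArg (ccomp M _) (eqArrow_cmk_right M _)).trans ((ccomp_right M _ _ _).trans
      (Eq.trans ?_ ((congrArg (fun x => ccomp M x _) (eqArrow_cmk_left M _)).trans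
        (ccomp_left M _ f g)).symm))
    exact cmk_eqArrow M _ _ _ _ _ _ _ (C.unit_tensor f) (C.unit_tensor g)
  tensor_unit := by
    rintro a b ⟨⟨n, f, g⟩⟩
    refine (congrArg (ccomp M _) (eqArrow_cmk_right M _)).trans ((ccomp_right M _ _ _).trans
      (Eq.trans ?_ ((congrArg (fun x => ccomp M x _) (eqArrow_cmk_left M _)).trans
        (ccomp_left M _ f g)).symm))
    exact cmk_eqArrow M _ _ _ _ _ _ _ (C.tensor_unit f) (C.tensor_unit g)
  symm a b := cmk M (C.symm a b) (C.id (b + a))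
  symm_natural := by
    rintro a b a' b' ⟨⟨n, f, g⟩⟩ ⟨⟨n', f', g'⟩⟩
    refine (congrArg (ccomp M _) (cmk_symm M b b')).trans ((ccomp_right M _ _ _).trans
      (Eq.trans ?_ (ccomp_left M _ _ _).symm))
    refine cmk_sound (C.symm n n') (mem_of_inv _ _ (C.symm_symm n n') (C.symm_symm n' n))
      (C.symm_natural f f') ?_
    change C.comp (C.comp (C.symm b' b) (C.tensor g g')) (C.symm n n') = C.tensor g' g
    rw [C.assoc, C.symm_natural, ← C.assoc, C.symm_symm, C.id_comp]
  symm_symm a b := by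
    rw [ccomp_left M, C.symm_symm]
  hexagon a b c := by
    simp only [eqArrow_cmk_left]
    have e := C.hexagon a b c
    change _ = ccomp M (ccomp M (cmk M (C.tensor _ _) (C.tensor _ _)) _)
      (cmk M (C.tensor _ _) (C.tensor _ _))
    simp only [ccomp_left, C.tensor_id]
    rw [← e]

/-- The inclusion of `C`, sending `f` to the class of the cospan with legs `f` and `id`. -/
noncomputable def modOf [TensorPushouts C] [TensorClosed M] : C ⟶ cospMod M :=
  Mor.mk (P := C) (Q := cospMod M) (fun {_ b} f => cmk M f (C.id b)) (fun _ => rfl)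
    (fun f g => (ccomp_left M f g (C.id _)).symm)
    (fun f g => by
      change _ = cmk M (C.tensor _ _) (C.tensor _ _)
      rw [C.tensor_id])
    (fun _ _ => rfl)

/-- The inclusion of the opposite of `C`, sending `g` to the class of the cospan with legs `id`
and `g`. -/
noncomputable def modOfOp [TensorPushouts C] [TensorClosed M] : C.op ⟶ cospMod M :=
  Mor.mk (P := C.op) (Q := cospMod M) (fun {a _} g => cmk M (C.id a) g) (fun _ => rfl)
    (fun {a b c} f g => (ccomp_right M (C.id a) (show C.Hom b a from f) g).symm)
    (fun f g => by
      change _ = cmk M (C.tensor _ _) (C.tensor _ _)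
      rw [C.tensor_id]; rfl)
    (fun a b => (cmk_symm M a b).symm)

end CospMod

instance (C : PROP) : TensorClosed (MorphismProperty.isomorphisms C.Ob) where
  tensor := by
    rintro a b c d f g ⟨f', h1, h2⟩ ⟨g', h3, h4⟩
    exact ⟨C.tensor (a := b) (b := a) (c := d) (d := c) f' g', C.tensor_inv h1 h3,
      C.tensor_inv h2 h4⟩

/-- The prop of cospans in `C`: arrows are isomorphism classes of cospans, i.e. classes of cospans
modulo isomorphisms between the apexes. -/
noncomputable def Cospan (C : PROP) [TensorPushouts C] : PROP :=
  cospMod (MorphismProperty.isomorphisms C.Ob)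

/-- The prop of spans in `A`, i.e. of cospans in the opposite of `A`: an arrow `a ⟶ b` is an
isomorphism class of spans `a ⟵ n ⟶ b` in `A`, and composition is by pullback in `A`. -/
noncomputable abbrev Span (A : PROP) [TensorPushouts A.op] : PROP := Cospan A.op

/-- The isomorphism class of the cospan `a ⟶ n ⟵ b` with legs `f` and `g`. -/
def Cospan.mk {C : PROP} [TensorPushouts C] {a b n : ℕ} (f : C.Hom a n) (g : C.Hom b n) :
    (Cospan C).Hom a b :=
  cmk (MorphismProperty.isomorphisms C.Ob) f g

/-- The isomorphism class of the span `a ⟵ n ⟶ b` with legs `f` and `g`. -/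
def Span.mk {A : PROP} [TensorPushouts A.op] {a b n : ℕ} (f : A.Hom n a) (g : A.Hom n b) :
    (Span A).Hom a b :=
  Cospan.mk (C := A.op) f g

/-- The morphism `C ⟶ Cospan C` sending `f` to the cospan with legs `f` and `id`. -/
noncomputable def cospanOf (C : PROP) [TensorPushouts C] : C ⟶ Cospan C := modOf _

/-- The morphism `C.op ⟶ Cospan C` sending `g` to the cospan with legs `id` and `g`. -/
noncomputable def cospanOfOp (C : PROP) [TensorPushouts C] : C.op ⟶ Cospan C := modOfOp _

/-- The morphism `A ⟶ Span A` sending `f` to the span with legs `id` and `f`. -/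
noncomputable def spanOf (A : PROP) [TensorPushouts A.op] : A ⟶ Span A := cospanOfOp A.op

/-- The morphism `A.op ⟶ Span A` sending `g` to the span with legs `g` and `id`. -/
noncomputable def spanOfOp (A : PROP) [TensorPushouts A.op] : A.op ⟶ Span A := cospanOf A.op

end PROP

/-- A costable factorisation system `(E, M)`: the classes `E` and `M` are subcategories containing
all isomorphisms, each arrow factors as an arrow of `E` followed by an arrow of `M`, these
factorisations are functorial in a unique way, and `M` is stable under pushout. -/
structure CostableFactorisation (X : Type) [Category.{0} X] where
  E : MorphismProperty X
  M : MorphismProperty X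
  E_mul : E.IsMultiplicative
  M_mul : M.IsMultiplicative
  E_iso {x y : X} (f : x ⟶ y) : IsIso f → E f
  M_iso {x y : X} (f : x ⟶ y) : IsIso f → M f
  fac {x y : X} (f : x ⟶ y) : ∃ (z : X) (e : x ⟶ z) (m : z ⟶ y), E e ∧ M m ∧ e ≫ m = f
  diag {x z y x' z' y' : X} (e : x ⟶ z) (m : z ⟶ y) (e' : x' ⟶ z') (m' : z' ⟶ y')
    (u : x ⟶ x') (v : y ⟶ y') : E e → M m → E e' → M m' → (e ≫ m) ≫ v = u ≫ e' ≫ m' →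
      ∃! s : z ⟶ z', e ≫ s = u ≫ e' ∧ m ≫ v = s ≫ m'
  M_costable : M.IsStableUnderCobaseChange

namespace PROP

instance {X : Type} [Category.{0} X] (F : CostableFactorisation X) :
    F.M.IsStableUnderCobaseChange := F.M_costable

instance {X : Type} [Category.{0} X] (F : CostableFactorisation X) :
    F.M.ContainsIdentities := F.M_mul.toContainsIdentities

/-- The prop of corelations in `C` with respect to a costable factorisation system `(E, M)` such
that `M` is closed under the monoidal product: arrows are classes of cospans modulo the equivalence
relation generated by the arrows of `M` between the apexes. -/
noncomputable def Corel (C : PROP) [TensorPushouts C] (F : CostableFactorisation C.Ob)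
    [TensorClosed F.M] : PROP :=
  cospMod F.M

/-- The corelation represented by the cospan `a ⟶ n ⟵ b` with legs `f` and `g`. -/
def Corel.mk {C : PROP} [TensorPushouts C] (F : CostableFactorisation C.Ob) [TensorClosed F.M]
    {a b n : ℕ} (f : C.Hom a n) (g : C.Hom b n) : (Corel C F).Hom a b :=
  cmk F.M f g

/-- The morphism of props sending a cospan to the corelation it represents. -/
noncomputable def toCorel (C : PROP) [TensorPushouts C] (F : CostableFactorisation C.Ob)
    [TensorClosed F.M] : Cospan C ⟶ Corel C F :=
  Mor.mk (P := Cospan C) (Q := Corel C F)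
    (Quot.lift (fun s => Corel.mk F s.left s.right)
      (fun _ _ ⟨m, hm, hl, hr⟩ => cmk_sound m (F.M_iso _ hm) hl hr))
    (fun _ => rfl)
    (by
      rintro a b c ⟨⟨n, f, g⟩⟩ ⟨⟨n', f', g'⟩⟩
      obtain ⟨p, i, j, h⟩ := exists_pushout g f'
      refine Eq.trans (congrArg _ (ccomp_eq _ f g f' g' h)) (ccomp_eq F.M f g f' g' h).symm)
    (by rintro a b c d ⟨s⟩ ⟨t⟩; rfl)
    (fun _ _ => rfl)

end PROP

namespace PROP

/-- A prop structure induced along an injective family of maps into a prop. -/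
def ofFaithful (P : PROP) (H : ℕ → ℕ → Type) (φ : ∀ {a b : ℕ}, H a b → P.Hom a b)
    (inj : ∀ {a b : ℕ} (f g : H a b), φ f = φ g → f = g)
    (id : ∀ a, H a a) (comp : ∀ {a b c : ℕ}, H a b → H b c → H a c)
    (tensor : ∀ {a b c d : ℕ}, H a b → H c d → H (a + c) (b + d))
    (symm : ∀ a b, H (a + b) (b + a))
    (h_id : ∀ a, φ (id a) = P.id a)
    (h_comp : ∀ {a b c : ℕ} (f : H a b) (g : H b c), φ (comp f g) = P.comp (φ f) (φ g))
    (h_tensor : ∀ {a b c d : ℕ} (f : H a b) (g : H c d),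
      φ (tensor f g) = P.tensor (φ f) (φ g))
    (h_symm : ∀ a b, φ (symm a b) = P.symm a b) : PROP :=
  have h_eq : ∀ {a b : ℕ} (h : a = b), φ (eqArrow id h) = eqArrow P.id h := by
    rintro a b rfl; exact h_id a
  { Hom := H
    id := id
    comp := comp
    id_comp := fun f => inj _ _ (by rw [h_comp, h_id, P.id_comp])
    comp_id := fun f => inj _ _ (by rw [h_comp, h_id, P.comp_id])
    assoc := fun f g h => inj _ _ (by simp only [h_comp, P.assoc])
    tensor := tensor
    tensor_id := fun a b => inj _ _ (by simp only [h_tensor, h_id, P.tensor_id])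
    tensor_comp := fun f g f' g' => inj _ _ (by simp only [h_tensor, h_comp, P.tensor_comp])
    tensor_assoc := fun f g h => inj _ _ (by
      simp only [h_tensor, h_comp, h_eq, P.tensor_assoc])
    unit_tensor := fun f => inj _ _ (by simp only [h_tensor, h_comp, h_eq, h_id, P.unit_tensor])
    tensor_unit := fun f => inj _ _ (by simp only [h_tensor, h_comp, h_eq, h_id, P.tensor_unit])
    symm := symm
    symm_natural := fun f g => inj _ _ (by
      simp only [h_tensor, h_comp, h_symm, P.symm_natural])
    symm_symm := fun a b => inj _ _ (by simp only [h_comp, h_symm, h_id, P.symm_symm])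
    hexagon := fun a b c => inj _ _ (by
      simp only [h_tensor, h_comp, h_symm, h_id, h_eq, P.hexagon]) }

/-! ### Partial functions and injections -/

/-- The monoidal product of two partial functions. -/
def pfTensor {a b c d : ℕ} (f : Fin a → Option (Fin b)) (g : Fin c → Option (Fin d)) :
    Fin (a + c) → Option (Fin (b + d)) :=
  Fin.addCases (fun i => (f i).map (Fin.castAdd d)) (fun j => (g j).map (Fin.natAdd b))

/-- The block permutation. -/
def swapFin (a b : ℕ) : Fin (a + b) → Fin (b + a) :=
  Fin.addCases (Fin.natAdd b) (Fin.castAdd a)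

theorem eqArrow_pf {a b : ℕ} (h : a = b) :
    eqArrow (H := fun a b => Fin a → Option (Fin b)) (fun _ => some) h
      = fun i => some (Fin.cast h i) := by
  cases h; rfl

@[simp] theorem pfTensor_castAdd {a b c d : ℕ} (f : Fin a → Option (Fin b))
    (g : Fin c → Option (Fin d)) (i : Fin a) :
    pfTensor f g (Fin.castAdd c i) = (f i).map (Fin.castAdd d) := by
  simp [pfTensor]

@[simp] theorem pfTensor_natAdd {a b c d : ℕ} (f : Fin a → Option (Fin b))
    (g : Fin c → Option (Fin d)) (i : Fin c) :
    pfTensor f g (Fin.natAdd a i) = (g i).map (Fin.natAdd b) := by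
  simp [pfTensor]

@[simp] theorem swapFin_castAdd (a b : ℕ) (i : Fin a) :
    swapFin a b (Fin.castAdd b i) = Fin.natAdd b i := by simp [swapFin]

@[simp] theorem swapFin_natAdd (a b : ℕ) (i : Fin b) :
    swapFin a b (Fin.natAdd a i) = Fin.castAdd a i := by simp [swapFin]

@[elab_as_elim] theorem fin_cases_add {a b : ℕ} {motive : Fin (a + b) → Prop} (i : Fin (a + b))
    (h : ∀ i, motive (Fin.castAdd b i)) (h' : ∀ i, motive (Fin.natAdd a i)) : motive i :=
  Fin.addCases h h' i

/-- The prop of partial functions: an arrow `a ⟶ b` is a partial function from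
`{0, …, a - 1}` to `{0, …, b - 1}`, and the monoidal product is the disjoint union. -/
def PF : PROP where
  Hom a b := Fin a → Option (Fin b)
  id _ := some
  comp f g := fun i => (f i).bind g
  id_comp f := by funext i; rfl
  comp_id f := by funext i; simp
  assoc f g h := by funext i; simp [Option.bind_assoc]
  tensor f g := pfTensor f g
  tensor_id a b := by
    funext i; refine fin_cases_add i (fun i => ?_) (fun i => ?_) <;> simp
  tensor_comp {a b c a' b' c'} f g f' g' := by
    funext i
    refine fin_cases_add i (fun i => ?_) (fun i => ?_)
    · simp only [pfTensor_castAdd]; cases f i <;> simp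
    · simp only [pfTensor_natAdd]; cases f' i <;> simp
  tensor_assoc {a b a' b' a'' b''} f g h := by
    funext i
    simp only [eqArrow_pf]
    refine fin_cases_add i (fun i => ?_) (fun i => ?_)
    · refine fin_cases_add i (fun i => ?_) (fun i => ?_)
      · have e : Fin.cast (Nat.add_assoc a a' a'') (Fin.castAdd a'' (Fin.castAdd a' i))
            = Fin.castAdd _ i := by ext; simp
        simp only [pfTensor_castAdd, Option.bind_some, e]; cases f i <;> simp; ext; simp
      · have e : Fin.cast (Nat.add_assoc a a' a'') (Fin.castAdd a'' (Fin.natAdd a i))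
            = Fin.natAdd _ (Fin.castAdd _ i) := by ext; simp
        simp only [pfTensor_castAdd, pfTensor_natAdd, Option.bind_some, e]
        cases g i <;> simp; ext; simp
    · have e : Fin.cast (Nat.add_assoc a a' a'') (Fin.natAdd (a + a') i)
          = Fin.natAdd _ (Fin.natAdd _ i) := by ext; simp [Nat.add_assoc]
      simp only [pfTensor_natAdd, Option.bind_some, e]
      cases h i <;> simp; ext; simp [Nat.add_assoc]
  unit_tensor {a b} f := by
    funext i
    simp only [eqArrow_pf]
    refine fin_cases_add i (fun i => i.elim0) (fun i => ?_)
    have e : Fin.cast (Nat.zero_add a) (Fin.natAdd 0 i) = i := by ext; simp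
    simp only [pfTensor_natAdd, Option.bind_some, e]
    cases f i <;> simp
  tensor_unit {a b} f := by
    funext i
    simp only [eqArrow_pf]
    refine fin_cases_add i (fun i => ?_) (fun i => i.elim0)
    simp only [pfTensor_castAdd, Option.bind_some]
    have e : Fin.cast (Nat.add_zero a) (Fin.castAdd 0 i) = i := by ext; simp
    rw [e]
    cases f i <;> simp
  symm a b := fun i => some (swapFin a b i)
  symm_natural f g := by
    funext i
    refine fin_cases_add i (fun i => ?_) (fun i => ?_)
    · simp only [pfTensor_castAdd, swapFin_castAdd, Option.bind_some, pfTensor_natAdd]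
      cases f i <;> simp
    · simp only [pfTensor_castAdd, swapFin_natAdd, Option.bind_some, pfTensor_natAdd]
      cases g i <;> simp
  symm_symm a b := by
    funext i
    refine fin_cases_add i (fun i => ?_) (fun i => ?_) <;> simp
  hexagon a b c := by
    funext i
    simp only [eqArrow_pf]
    refine fin_cases_add i (fun i => ?_) (fun i => ?_)
    · refine fin_cases_add i (fun i => ?_) (fun i => ?_)
      · have e : Fin.cast (Nat.add_assoc a b c) (Fin.castAdd c (Fin.castAdd b i))
            = Fin.castAdd _ i := by ext; simp
        have e' : Fin.cast (Nat.add_assoc b a c) (Fin.castAdd c (Fin.natAdd b i))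
            = Fin.natAdd _ (Fin.castAdd _ i) := by ext; simp
        simp [e, e']; ext; simp [Nat.add_assoc]
      · have e : Fin.cast (Nat.add_assoc a b c) (Fin.castAdd c (Fin.natAdd a i))
            = Fin.natAdd _ (Fin.castAdd _ i) := by ext; simp
        have e' : Fin.cast (Nat.add_assoc b a c) (Fin.castAdd c (Fin.castAdd a i))
            = Fin.castAdd _ i := by ext; simp
        simp [e, e']; ext; simp
    · have e : Fin.cast (Nat.add_assoc a b c) (Fin.natAdd (a + b) i)
          = Fin.natAdd _ (Fin.natAdd _ i) := by ext; simp [Nat.add_assoc]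
      have e' : Fin.cast (Nat.add_assoc b a c) (Fin.natAdd (b + a) i)
          = Fin.natAdd _ (Fin.natAdd _ i) := by ext; simp [Nat.add_assoc]
      simp [e, e']; ext; simp

/-- The disjoint union of two injections. -/
def injTensor {a b c d : ℕ} (f : Fin a ↪ Fin b) (g : Fin c ↪ Fin d) :
    Fin (a + c) ↪ Fin (b + d) where
  toFun := Fin.addCases (fun i => Fin.castAdd d (f i)) (fun j => Fin.natAdd b (g j))
  inj' := by
    intro i j
    refine fin_cases_add i (fun i => ?_) (fun i => ?_) <;>
      refine fin_cases_add j (fun j => ?_) (fun j => ?_) <;> intro h <;>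
      simp [Fin.ext_iff] at h ⊢
    · exact congrArg Fin.val (f.injective (Fin.ext h))
    · have := (f i).isLt; omega
    · have := (f j).isLt; omega
    · exact congrArg Fin.val (g.injective (Fin.ext h))

@[simp] theorem injTensor_castAdd {a b c d : ℕ} (f : Fin a ↪ Fin b) (g : Fin c ↪ Fin d)
    (i : Fin a) : injTensor f g (Fin.castAdd c i) = Fin.castAdd d (f i) := by
  change Fin.addCases (motive := fun _ => Fin (b + d)) (fun i => Fin.castAdd d (f i))
    (fun j => Fin.natAdd b (g j)) (Fin.castAdd c i) = _
  simp

@[simp] theorem injTensor_natAdd {a b c d : ℕ} (f : Fin a ↪ Fin b) (g : Fin c ↪ Fin d)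
    (i : Fin c) : injTensor f g (Fin.natAdd a i) = Fin.natAdd b (g i) := by
  change Fin.addCases (motive := fun _ => Fin (b + d)) (fun i => Fin.castAdd d (f i))
    (fun j => Fin.natAdd b (g j)) (Fin.natAdd a i) = _
  simp

theorem pfTensor_inj {a b c d : ℕ} (f : Fin a ↪ Fin b) (g : Fin c ↪ Fin d) :
    (fun i => some (injTensor f g i)) = pfTensor (fun i => some (f i)) (fun i => some (g i)) := by
  funext i
  refine fin_cases_add i (fun i => ?_) (fun i => ?_) <;> simp

/-- The block permutation, as an injection. -/
def injSwap (a b : ℕ) : Fin (a + b) ↪ Fin (b + a) where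
  toFun := swapFin a b
  inj' := Function.LeftInverse.injective (g := swapFin b a) (fun i => by
    refine fin_cases_add i (fun i => ?_) (fun i => ?_) <;> simp)

/-- The prop of injections: an arrow `a ⟶ b` is an injection from `{0, …, a - 1}` to
`{0, …, b - 1}`, and the monoidal product is the disjoint union. -/
def Inj : PROP :=
  ofFaithful PF (fun a b => Fin a ↪ Fin b) (fun f i => some (f i))
    (fun f g h => by ext i; exact congrArg Fin.val (Option.some.inj (congrFun h i)))
    (fun a => Function.Embedding.refl (Fin a)) (fun f g => f.trans g) injTensor injSwap
    (fun _ => rfl) (fun _ _ => rfl)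
    pfTensor_inj
    (fun _ _ => rfl)

/-- The inclusion of injections into partial functions. -/
def injPF : Inj ⟶ PF :=
  Mor.mk (P := Inj) (Q := PF) (fun {a b} (f : Fin a ↪ Fin b) i => some (f i))
    (fun _ => rfl) (fun _ _ => rfl)
    pfTensor_inj
    (fun _ _ => rfl)

end PROP

namespace PROP

/-! ### Pushouts of partial functions, pullbacks of injections -/

theorem PF.exists_isPushout {y n m : ℕ} (f : PF.Hom y n) (g : PF.Hom y m) :
    ∃ (p : ℕ) (i : PF.Hom n p) (j : PF.Hom m p), IsPushout (C := PF.Ob) f g i j := by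
  classical
  let r : Option (Fin n ⊕ Fin m) → Option (Fin n ⊕ Fin m) → Prop := fun u v =>
    ∃ k : Fin y, u = (f k).map Sum.inl ∧ v = (g k).map Sum.inr
  let S := {w : Quot r // w ≠ Quot.mk r none}
  have : Finite (Quot r) := Finite.of_surjective (Quot.mk r) Quot.mk_surjective
  obtain ⟨p, ⟨e⟩⟩ := Finite.exists_equiv_fin S
  let c : Quot r → Option (Fin p) := fun w => if h : w = Quot.mk r none then none else some (e ⟨w, h⟩)
  have c0 : c (Quot.mk r none) = none := dif_pos rfl
  have c1 : ∀ k : Fin p, c (e.symm k).1 = some k := fun k => by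
    simp only [c, dif_neg (e.symm k).2]; simp
  have c2 : ∀ {T : Type} (D : Quot r → Option T), D (Quot.mk r none) = none →
      ∀ w, (c w).bind (fun k => D (e.symm k).1) = D w := by
    intro T D hD w
    by_cases h : w = Quot.mk r none
    · subst h; rw [c0, hD]; rfl
    · simp [c, dif_neg h]
  refine ⟨p, fun x => c (Quot.mk r (some (Sum.inl x))), fun x => c (Quot.mk r (some (Sum.inr x))),
    IsPushout.mk' ?_ ?_ ?_⟩
  · funext k
    have h1 : (f k).bind (fun x => c (Quot.mk r (some (Sum.inl x)))) =
        c (Quot.mk r ((f k).map Sum.inl)) := by cases f k <;> simp [c0]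
    have h2 : (g k).bind (fun x => c (Quot.mk r (some (Sum.inr x)))) =
        c (Quot.mk r ((g k).map Sum.inr)) := by cases g k <;> simp [c0]
    exact h1.trans ((congrArg c (Quot.sound ⟨k, rfl, rfl⟩)).trans h2.symm)
  · intro T φ ψ h1 h2
    funext k
    have key : ∀ w, c w = some k → φ k = ψ k := by
      rintro ⟨o⟩ hw
      rcases o with _ | x | x
      · rw [c0] at hw; cases hw
      · have := congrFun h1 x
        change (c _).bind φ = (c _).bind ψ at this
        rwa [hw] at this
      · have := congrFun h2 x
        change (c _).bind φ = (c _).bind ψ at this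
        rwa [hw] at this
    exact key _ (c1 k)
  · intro T a b hab
    let D : Quot r → Option (Fin T) := Quot.lift (fun o => o.bind (Sum.elim a b)) (by
      rintro _ _ ⟨k, rfl, rfl⟩
      have := congrFun hab k
      change (f k).bind a = (g k).bind b at this
      cases hf : f k <;> cases hg : g k <;> simp [hf, hg] at this ⊢ <;> exact this)
    exact ⟨fun k => D (e.symm k).1, funext fun x => c2 D rfl _, funext fun x => c2 D rfl _⟩

/-- Partial functions on a disjoint union are determined on the summands. -/
theorem PF.ext_add {a b c : ℕ} {φ ψ : PF.Hom (a + b) c}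
    (h : ∀ i, φ (Fin.castAdd b i) = ψ (Fin.castAdd b i))
    (h' : ∀ i, φ (Fin.natAdd a i) = ψ (Fin.natAdd a i)) : φ = ψ := by
  funext i; exact fin_cases_add i h h'

theorem pfTensor_bind_castAdd {a b c d t : ℕ} (u : Fin a → Option (Fin b))
    (v : Fin c → Option (Fin d)) (w : Fin (b + d) → Option (Fin t)) (x : Fin a) :
    (pfTensor u v (Fin.castAdd c x)).bind w = (u x).bind fun k => w (Fin.castAdd d k) := by
  rw [pfTensor_castAdd]; cases u x <;> rfl

theorem pfTensor_bind_natAdd {a b c d t : ℕ} (u : Fin a → Option (Fin b))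
    (v : Fin c → Option (Fin d)) (w : Fin (b + d) → Option (Fin t)) (x : Fin c) :
    (pfTensor u v (Fin.natAdd a x)).bind w = (v x).bind fun k => w (Fin.natAdd b k) := by
  rw [pfTensor_natAdd]; cases v x <;> rfl

instance : TensorPushouts PF where
  hasPushouts :=
    have (y n m : PF.Ob) (f : y ⟶ n) (g : y ⟶ m) : HasColimit (span f g) := by
      obtain ⟨p, i, j, h⟩ := PF.exists_isPushout f g
      exact h.hasPushout
    hasPushouts_of_hasColimit_span _
  tensor {y n m p y' n' m' p' f g i j f' g' i' j'} h h' := by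
    have hw : PF.comp f i = PF.comp g j := h.w
    have hw' : PF.comp f' i' = PF.comp g' j' := h'.w
    have ev1 := fun {a b c d t : ℕ} (u : PF.Hom a b) (v : PF.Hom c d) (w : PF.Hom (b + d) t) x =>
      pfTensor_bind_castAdd u v w x
    have ev2 := fun {a b c d t : ℕ} (u : PF.Hom a b) (v : PF.Hom c d) (w : PF.Hom (b + d) t) x =>
      pfTensor_bind_natAdd u v w x
    refine IsPushout.mk' ?_ ?_ ?_
    · change PF.comp (PF.tensor f f') (PF.tensor i i') = PF.comp (PF.tensor g g') (PF.tensor j j')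
      rw [← PF.tensor_comp, ← PF.tensor_comp, hw, hw']
    · intro T φ ψ h1 h2
      refine PF.ext_add (fun k => ?_) (fun k => ?_)
      · refine congrFun (h.hom_ext (W := T) (k := fun k => φ (Fin.castAdd p' k))
          (l := fun k => ψ (Fin.castAdd p' k)) ?_ ?_) k
        · exact funext fun x => (ev1 i i' φ x).symm.trans ((congrFun h1 _).trans (ev1 i i' ψ x))
        · exact funext fun x => (ev1 j j' φ x).symm.trans ((congrFun h2 _).trans (ev1 j j' ψ x))
      · refine congrFun (h'.hom_ext (W := T) (k := fun k => φ (Fin.natAdd p k))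
          (l := fun k => ψ (Fin.natAdd p k)) ?_ ?_) k
        · exact funext fun x => (ev2 i i' φ x).symm.trans ((congrFun h1 _).trans (ev2 i i' ψ x))
        · exact funext fun x => (ev2 j j' φ x).symm.trans ((congrFun h2 _).trans (ev2 j j' ψ x))
    · intro T a b hab
      obtain ⟨u, hu1, hu2⟩ := h.exists_desc (W := T) (fun k => a (Fin.castAdd n' k))
        (fun k => b (Fin.castAdd m' k))
        (funext fun x => (ev1 f f' a x).symm.trans ((congrFun hab _).trans (ev1 g g' b x)))
      obtain ⟨v, hv1, hv2⟩ := h'.exists_desc (W := T) (fun k => a (Fin.natAdd n k))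
        (fun k => b (Fin.natAdd m k))
        (funext fun x => (ev2 f f' a x).symm.trans ((congrFun hab _).trans (ev2 g g' b x)))
      let w : PF.Hom (p + p') T := Fin.addCases u v
      have w1 : (fun k => w (Fin.castAdd p' k)) = u := funext fun k => Fin.addCases_left k
      have w2 : (fun k => w (Fin.natAdd p k)) = v := funext fun k => Fin.addCases_right k
      refine ⟨w, PF.ext_add (fun k => ?_) (fun k => ?_), PF.ext_add (fun k => ?_) (fun k => ?_)⟩
      · exact (ev1 i i' w k).trans (by rw [w1]; exact congrFun hu1 k)
      · exact (ev2 i i' w k).trans (by rw [w2]; exact congrFun hv1 k)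
      · exact (ev1 j j' w k).trans (by rw [w1]; exact congrFun hu2 k)
      · exact (ev2 j j' w k).trans (by rw [w2]; exact congrFun hv2 k)

/-- Pullback squares of injections. -/
theorem Inj.isPushout_op_iff {y n m p : ℕ} (f : Fin n ↪ Fin y) (g : Fin m ↪ Fin y) (i : Fin p ↪ Fin n)
    (j : Fin p ↪ Fin m) :
    IsPushout (C := Inj.op.Ob) (Z := y) (X := n) (Y := m) (P := p) f g i j ↔
      (∀ k, f (i k) = g (j k)) ∧ ∀ x x', f x = g x' → ∃ k, i k = x ∧ j k = x' := by
  constructor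
  · intro h
    refine ⟨fun k => DFunLike.congr_fun (F := Fin p ↪ Fin y) h.w k, fun x x' e => ?_⟩
    let a : Fin 1 ↪ Fin n := ⟨fun _ => x, fun _ _ _ => Subsingleton.elim _ _⟩
    let b : Fin 1 ↪ Fin m := ⟨fun _ => x', fun _ _ _ => Subsingleton.elim _ _⟩
    obtain ⟨d, h1, h2⟩ := h.exists_desc (W := (1 : ℕ)) a b
      (DFunLike.ext (F := Fin 1 ↪ Fin y) _ _ fun _ => e)
    exact ⟨(show Fin 1 ↪ Fin p from d) 0, DFunLike.congr_fun (F := Fin 1 ↪ Fin n) h1 0,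
      DFunLike.congr_fun (F := Fin 1 ↪ Fin m) h2 0⟩
  · rintro ⟨hw, hu⟩
    refine IsPushout.mk' (DFunLike.ext (F := Fin p ↪ Fin y) _ _ hw) ?_ ?_
    · intro (T : ℕ) (φ : Fin T ↪ Fin p) (ψ : Fin T ↪ Fin p) h1 h2
      refine DFunLike.ext (F := Fin T ↪ Fin p) _ _ fun k => i.injective ?_
      exact DFunLike.congr_fun (F := Fin T ↪ Fin n) h1 k
    · intro (T : ℕ) (a : Fin T ↪ Fin n) (b : Fin T ↪ Fin m) hab
      have hab' : ∀ k, f (a k) = g (b k) := fun k => DFunLike.congr_fun (F := Fin T ↪ Fin y) hab k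
      choose d h1 h2 using fun k => hu (a k) (b k) (hab' k)
      refine ⟨(⟨d, fun k k' e => a.injective ?_⟩ : Fin T ↪ Fin p),
        DFunLike.ext (F := Fin T ↪ Fin n) _ _ h1, DFunLike.ext (F := Fin T ↪ Fin m) _ _ h2⟩
      rw [← h1, ← h1, e]

theorem injTensor_square {y n m p y' n' m' p' : ℕ} {f : Fin n ↪ Fin y} {g : Fin m ↪ Fin y}
    {i : Fin p ↪ Fin n} {j : Fin p ↪ Fin m} {f' : Fin n' ↪ Fin y'} {g' : Fin m' ↪ Fin y'}
    {i' : Fin p' ↪ Fin n'} {j' : Fin p' ↪ Fin m'}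
    (h1 : ∀ k, f (i k) = g (j k)) (h2 : ∀ x x', f x = g x' → ∃ k, i k = x ∧ j k = x')
    (h1' : ∀ k, f' (i' k) = g' (j' k))
    (h2' : ∀ x x', f' x = g' x' → ∃ k, i' k = x ∧ j' k = x') :
    (∀ k, injTensor f f' (injTensor i i' k) = injTensor g g' (injTensor j j' k)) ∧
      ∀ x x', injTensor f f' x = injTensor g g' x' →
        ∃ k, injTensor i i' k = x ∧ injTensor j j' k = x' := by
  refine ⟨fun k => ?_, fun x x' => ?_⟩
  · refine fin_cases_add k (fun k => ?_) (fun k => ?_) <;> simp [h1, h1']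
  · refine fin_cases_add x (fun x => ?_) (fun x => ?_) <;>
      refine fin_cases_add x' (fun x' => ?_) (fun x' => ?_) <;>
      simp only [injTensor_castAdd, injTensor_natAdd] <;> intro e
    · obtain ⟨k, hk, hk'⟩ := h2 x x' (Fin.castAdd_injective _ _ e)
      exact ⟨Fin.castAdd p' k, by simp [hk], by simp [hk']⟩
    · have := congrArg Fin.val e
      have := (f x).isLt
      simp at *; omega
    · have := congrArg Fin.val e
      have := (g x').isLt
      simp at *; omega
    · obtain ⟨k, hk, hk'⟩ := h2' x x' (Fin.natAdd_injective _ _ e)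
      exact ⟨Fin.natAdd p k, by simp [hk], by simp [hk']⟩

instance : TensorPushouts Inj.op where
  hasPushouts :=
    have (y n m : Inj.op.Ob) (f : y ⟶ n) (g : y ⟶ m) : HasColimit (span f g) := by
      revert f g
      change ℕ at y n m
      intro (f' : Fin n ↪ Fin y) (g' : Fin m ↪ Fin y)
      obtain ⟨p, ⟨e⟩⟩ := Finite.exists_equiv_fin {x : Fin n × Fin m // f' x.1 = g' x.2}
      let i : Fin p ↪ Fin n := ⟨fun k => (e.symm k).1.1, fun k k' h => e.symm.injective
        (Subtype.ext (Prod.ext h (g'.injective (by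
          rw [← (e.symm k).2, ← (e.symm k').2]; exact congrArg f' h))))⟩
      let j : Fin p ↪ Fin m := ⟨fun k => (e.symm k).1.2, fun k k' h => e.symm.injective
        (Subtype.ext (Prod.ext (f'.injective (by
          rw [(e.symm k).2, (e.symm k').2]; exact congrArg g' h)) h))⟩
      have h := (Inj.isPushout_op_iff f' g' i j).2 ⟨fun k => (e.symm k).2, fun x x' h =>
        ⟨e ⟨(x, x'), h⟩, congrArg (fun w => w.1.1) (e.symm_apply_apply _),
          congrArg (fun w => w.1.2) (e.symm_apply_apply _)⟩⟩
      exact h.hasPushout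
    hasPushouts_of_hasColimit_span _
  tensor {y n m p y' n' m' p' f g i j f' g' i' j'} h h' := by
    obtain ⟨h1, h2⟩ := (Inj.isPushout_op_iff f g i j).1 h
    obtain ⟨h1', h2'⟩ := (Inj.isPushout_op_iff f' g' i' j').1 h'
    exact (Inj.isPushout_op_iff (injTensor f f') (injTensor g g') (injTensor i i')
      (injTensor j j')).2 (injTensor_square h1 h2 h1' h2')

/-! ### The factorisation system on partial functions -/

/-- Partial surjections. -/
def isSurj : MorphismProperty PF.Ob :=
  fun (a b : ℕ) (f : Fin a → Option (Fin b)) => ∀ k, ∃ i, f i = some k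

/-- Injections, i.e. total injective functions. -/
def isInj : MorphismProperty PF.Ob :=
  fun (a b : ℕ) (f : Fin a → Option (Fin b)) => ∃ g : Fin a ↪ Fin b, ∀ i, f i = some (g i)

theorem isInj.total {a b : ℕ} {f : PF.Hom a b} (h : isInj (X := a) (Y := b) f) (i : Fin a) :
    f i ≠ none := by
  obtain ⟨g, hg⟩ := h; rw [hg]; simp

theorem isInj.inj {a b : ℕ} {f : PF.Hom a b} (h : isInj (X := a) (Y := b) f) {i j : Fin a}
    (e : f i = f j) : i = j := by
  obtain ⟨g, hg⟩ := h; rw [hg, hg] at e; exact g.injective (Option.some.inj e)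

/-- A cancellation property of injections. -/
theorem isInj.cancel {a b : ℕ} {f : PF.Hom a b} (h : isInj (X := a) (Y := b) f)
    {x y : Option (Fin a)} (e : x.bind f = y.bind f) : x = y := by
  rcases x with _ | x <;> rcases y with _ | y
  · rfl
  · exact absurd e.symm (h.total y)
  · exact absurd e (h.total x)
  · exact congrArg some (h.inj e)

theorem isInj_of_retract {a b : ℕ} {f : PF.Hom a b} {r : PF.Hom b a}
    (h : PF.comp f r = PF.id a) : isInj (X := a) (Y := b) f := by
  have h' : ∀ i, (f i).bind r = some i := fun i => congrFun h i
  choose g hg using fun i => Option.isSome_iff_exists.1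
    (show (f i).isSome by
      by_contra hn
      have := h' i
      rw [Option.not_isSome_iff_eq_none.1 hn] at this
      cases this)
  refine ⟨⟨g, fun i j e => ?_⟩, hg⟩
  have h1 := h' i
  have h2 := h' j
  rw [hg] at h1 h2
  rw [e] at h1
  exact Option.some.inj (h1.symm.trans h2)

theorem pf_fac {a b : ℕ} (f : Fin a → Option (Fin b)) :
    ∃ (z : ℕ) (e : Fin a → Option (Fin z)) (m : Fin z → Option (Fin b)),
      isSurj (X := a) (Y := z) e ∧ isInj (X := z) (Y := b) m ∧ (fun i => (e i).bind m) = f := by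
  classical
  obtain ⟨z, ⟨e⟩⟩ := Finite.exists_equiv_fin {k : Fin b // ∃ i, f i = some k}
  refine ⟨z, fun i => if h : ∃ k, f i = some k then some (e ⟨h.choose, i, h.choose_spec⟩)
    else none, fun l => some (e.symm l).1,
    fun l => ?_, ⟨⟨fun l => (e.symm l).1, fun l l' h => e.symm.injective (Subtype.ext h)⟩,
      fun _ => rfl⟩, funext fun i => ?_⟩
  · obtain ⟨i, hi⟩ := (e.symm l).2
    have h : ∃ k, f i = some k := ⟨_, hi⟩
    refine ⟨i, (dif_pos h).trans (congrArg some ?_)⟩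
    rw [← Equiv.eq_symm_apply]
    exact Subtype.ext (Option.some.inj (h.choose_spec.symm.trans hi))
  · by_cases h : ∃ k, f i = some k
    · simp only [dif_pos h]
      refine Eq.trans ?_ h.choose_spec.symm
      simp
    · simp only [dif_neg h]
      exact (Option.eq_none_iff_forall_ne_some.2 fun k hk => h ⟨k, hk⟩).symm

theorem pf_diag {x z y x' z' y' : ℕ} (e : Fin x → Option (Fin z)) (m : Fin z → Option (Fin y))
    (e' : Fin x' → Option (Fin z')) (m' : Fin z' → Option (Fin y')) (u : Fin x → Option (Fin x'))
    (v : Fin y → Option (Fin y')) (he : ∀ k, ∃ i, e i = some k)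
    (hm' : isInj (X := z') (Y := y') m')
    (h : (fun i => ((e i).bind m).bind v) = fun i => (u i).bind fun k => (e' k).bind m') :
    ∃! s : Fin z → Option (Fin z'), (fun i => (e i).bind s) = (fun i => (u i).bind e') ∧
      (fun i => (m i).bind v) = fun i => (s i).bind m' := by
  choose c hc using he
  have h' : ∀ i, ((e i).bind fun k => (m k).bind v) = ((u i).bind e').bind m' := fun i =>
    (Option.bind_assoc _ _ _).symm.trans ((congrFun h i).trans (Option.bind_assoc _ _ _).symm)
  refine ⟨fun k => (u (c k)).bind e', ⟨funext fun i => ?_, funext fun k => ?_⟩,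
    fun s hs => funext fun k => ?_⟩
  · refine isInj.cancel hm' ?_
    rw [← h', Option.bind_assoc]
    congr 1
    funext k
    rw [← h', hc]; rfl
  · have := h' (c k)
    rwa [hc] at this
  · have := congrFun hs.1 (c k)
    simp only [hc] at this
    exact this

/-- The factorisation system on partial functions given by partial surjections and injections. -/
def PFfact : CostableFactorisation PF.Ob where
  E := isSurj
  M := isInj
  E_mul :=
    { id_mem := fun _ k => ⟨k, rfl⟩
      comp_mem := fun {a b c} f g hf hg k => by
        obtain ⟨j, hj⟩ := hg k
        obtain ⟨i, hi⟩ := hf j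
        exact ⟨i, (congrArg (fun o => Option.bind o g) hi).trans hj⟩ }
  M_mul :=
    { id_mem := fun _ => ⟨Function.Embedding.refl _, fun _ => rfl⟩
      comp_mem := fun {a b c} f g ⟨f', hf⟩ ⟨g', hg⟩ => ⟨f'.trans g', fun i =>
        (congrArg (fun o => Option.bind o g) (hf i)).trans (hg _)⟩ }
  E_iso {a b} f := by
    rintro ⟨g, h1, h2⟩ k
    have e : (show Option (Fin a) from g k).bind f = some k := congrFun h2 k
    obtain ⟨i, _, hi⟩ := Option.bind_eq_some_iff.1 e
    exact ⟨i, hi⟩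
  M_iso f := by
    rintro ⟨g, h1, h2⟩
    exact isInj_of_retract (r := g) h1
  fac f := pf_fac f
  diag e m e' m' u v he _ _ hm' h := pf_diag e m e' m' u v he hm' h
  M_costable :=
    { of_isPushout := by
        classical
        intro (A : ℕ) (A' : ℕ) (B : ℕ) (B' : ℕ) f g f' g' sq ⟨φ, hφ⟩
        let q : Fin A' → Option (Fin B) := fun x =>
          if h : ∃ k, φ k = x then g h.choose else none
        have hq : ∀ k, q (φ k) = g k := fun k => by
          have h : ∃ k', φ k' = φ k := ⟨k, rfl⟩
          simp only [q, dif_pos h]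
          rw [φ.injective h.choose_spec]
        obtain ⟨r, h1, h2⟩ := sq.exists_desc (W := B) (PF.id B) q (funext fun k => by
          change Option.bind (g k) some = Option.bind (f k) q
          rw [hφ]
          rw [Option.bind_fun_some]; exact (hq k).symm)
        exact isInj_of_retract (r := r) h1 }

instance : TensorClosed PFfact.M where
  tensor := by
    rintro a b c d f g ⟨f', hf⟩ ⟨g', hg⟩
    refine ⟨injTensor f' g', fun i => ?_⟩
    have e1 : f = fun i => some (f' i) := funext hf
    have e2 : g = fun i => some (g' i) := funext hg
    subst e1 e2
    exact (congrFun (pfTensor_inj f' g') i).symm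

end PROP

/-! ### Partial equivalence relations -/

/-- A partial equivalence relation: a symmetric and transitive relation. -/
@[ext] structure PERel (X : Type) where
  rel : X → X → Prop
  symm {x y : X} : rel x y → rel y x
  trans {x y z : X} : rel x y → rel y z → rel x z

namespace PERel

theorem refl_left {X : Type} (e : PERel X) {x y : X} (h : e.rel x y) : e.rel x x :=
  e.trans h (e.symm h)

theorem refl_right {X : Type} (e : PERel X) {x y : X} (h : e.rel x y) : e.rel y y :=
  e.trans (e.symm h) h

/-- The kernel of a partial function: two elements are related if the function is defined and takes
the same value at both of them. -/
def ker {X Y : Type} (f : X → Option Y) : PERel X where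
  rel x y := ∃ k, f x = some k ∧ f y = some k
  symm := fun ⟨k, h, h'⟩ => ⟨k, h', h⟩
  trans := by
    rintro x y z ⟨k, h, h'⟩ ⟨l, h'', h'''⟩
    rw [h'] at h''
    cases h''
    exact ⟨k, h, h'''⟩

variable {A Z B : Type}

/-- Two elements of `A ⊎ Z ⊎ B` are directly linked if they are related by `e` or by `e'`. -/
def Step (e : PERel (A ⊕ Z)) (e' : PERel (Z ⊕ B)) (u v : A ⊕ (Z ⊕ B)) : Prop :=
  (∃ x y, e.rel x y ∧ Sum.map id Sum.inl x = u ∧ Sum.map id Sum.inl y = v) ∨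
    ∃ x y, e'.rel x y ∧ Sum.inr x = u ∧ Sum.inr y = v

/-- The gluing of `e` and `e'` along `Z`: the smallest partial equivalence relation on
`A ⊎ Z ⊎ B` that contains both. -/
def Glue (e : PERel (A ⊕ Z)) (e' : PERel (Z ⊕ B)) : A ⊕ (Z ⊕ B) → A ⊕ (Z ⊕ B) → Prop :=
  Relation.TransGen (Step e e')

theorem Step.symm {e : PERel (A ⊕ Z)} {e' : PERel (Z ⊕ B)} {u v : A ⊕ (Z ⊕ B)}
    (h : Step e e' u v) : Step e e' v u := by
  rcases h with ⟨x, y, h, hx, hy⟩ | ⟨x, y, h, hx, hy⟩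
  · exact Or.inl ⟨y, x, e.symm h, hy, hx⟩
  · exact Or.inr ⟨y, x, e'.symm h, hy, hx⟩

theorem Glue.symm {e : PERel (A ⊕ Z)} {e' : PERel (Z ⊕ B)} {u v : A ⊕ (Z ⊕ B)}
    (h : Glue e e' u v) : Glue e e' v u := by
  induction h with
  | single h => exact .single h.symm
  | tail _ h ih => exact .head h.symm ih

/-- Composition of partial equivalence relations: glue along `Z` and restrict to `A ⊎ B`, where an
element that is linked to an element of `Z` at which `e` or `e'` is undefined becomes undefined.
If `e` and `e'` are (total) equivalence relations the second clause is void, and this is the usual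
composition of equivalence relations. -/
def comp (e : PERel (A ⊕ Z)) (e' : PERel (Z ⊕ B)) : PERel (A ⊕ B) where
  rel x y := Glue e e' (Sum.map id Sum.inr x) (Sum.map id Sum.inr y) ∧
    ∀ z : Z, Glue e e' (Sum.map id Sum.inr x) (Sum.inr (Sum.inl z)) →
      e.rel (Sum.inr z) (Sum.inr z) ∧ e'.rel (Sum.inl z) (Sum.inl z)
  symm := fun ⟨h, h'⟩ => ⟨h.symm, fun z hz => h' z (h.trans hz)⟩
  trans := fun ⟨h, h'⟩ ⟨k, _⟩ => ⟨h.trans k, h'⟩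

/-- The disjoint union of two partial equivalence relations on `a ⊎ b` and on `c ⊎ d`. -/
def tensor {a b c d : ℕ} (e : PERel (Fin a ⊕ Fin b)) (e' : PERel (Fin c ⊕ Fin d)) :
    PERel (Fin (a + c) ⊕ Fin (b + d)) where
  rel u v :=
    (∃ x y, e.rel x y ∧ Sum.map (Fin.castAdd c) (Fin.castAdd d) x = u ∧
        Sum.map (Fin.castAdd c) (Fin.castAdd d) y = v) ∨
      ∃ x y, e'.rel x y ∧ Sum.map (Fin.natAdd a) (Fin.natAdd b) x = u ∧
        Sum.map (Fin.natAdd a) (Fin.natAdd b) y = v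
  symm := by
    rintro u v (⟨x, y, h, hx, hy⟩ | ⟨x, y, h, hx, hy⟩)
    · exact Or.inl ⟨y, x, e.symm h, hy, hx⟩
    · exact Or.inr ⟨y, x, e'.symm h, hy, hx⟩
  trans := by
    have disj : ∀ (x : Fin a ⊕ Fin b) (y : Fin c ⊕ Fin d),
        Sum.map (Fin.castAdd c) (Fin.castAdd d) x ≠ Sum.map (Fin.natAdd a) (Fin.natAdd b) y := by
      rintro (x | x) (y | y) h <;> simp [Fin.ext_iff] at h <;> have := x.isLt <;> omega
    have i1 : Function.Injective (Sum.map (Fin.castAdd (m := c) (n := a))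
        (Fin.castAdd (m := d) (n := b))) :=
      Function.Injective.sumMap (Fin.castAdd_injective _ _) (Fin.castAdd_injective _ _)
    have i2 : Function.Injective (Sum.map (Fin.natAdd (n := a) (m := c))
        (Fin.natAdd (n := b) (m := d))) :=
      Function.Injective.sumMap (Fin.natAdd_injective _ _) (Fin.natAdd_injective _ _)
    rintro u v w (⟨x, y, h, hx, hy⟩ | ⟨x, y, h, hx, hy⟩) (⟨x', y', h', hx', hy'⟩ | ⟨x', y', h', hx', hy'⟩)
    · cases i1 (hy.trans hx'.symm); exact Or.inl ⟨x, y', e.trans h h', hx, hy'⟩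
    · exact absurd (hy.trans hx'.symm) (disj _ _)
    · exact absurd (hy.trans hx'.symm).symm (disj _ _)
    · cases i2 (hy.trans hx'.symm); exact Or.inr ⟨x, y', e'.trans h h', hx, hy'⟩

/-- A union of equivalence classes. -/
def Closed {X : Type} (e : PERel X) (W : X → Prop) : Prop :=
  (∀ x, W x → e.rel x x) ∧ ∀ x y, e.rel x y → W x → W y

theorem closed_class {X : Type} (e : PERel X) (x : X) : e.Closed (e.rel x) :=
  ⟨fun _ h => e.refl_right h, fun _ _ h h' => e.trans h' h⟩

theorem ext_of_closed {X : Type} {e e' : PERel X} (h : ∀ W, e.Closed W ↔ e'.Closed W) : e = e' := by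
  have key : ∀ {e e' : PERel X}, (∀ W, e.Closed W ↔ e'.Closed W) → ∀ x y, e.rel x y → e'.rel x y := by
    intro e e' h x y hxy
    have h1 : e'.rel x x := ((h _).1 (e.closed_class x)).1 x (e.refl_left hxy)
    exact ((h _).2 (e'.closed_class x)).2 x y hxy h1
  ext x y
  exact ⟨key h x y, key (fun W => (h W).symm) x y⟩

theorem closed_ker {X Y : Type} (f : X → Y) (W : X → Prop) :
    (ker fun x => some (f x)).Closed W ↔ ∀ x y, f x = f y → W x → W y := by
  constructor
  · exact fun h x y hxy => h.2 x y ⟨f x, rfl, by rw [hxy]⟩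
  · refine fun h => ⟨fun x _ => ⟨f x, rfl, rfl⟩, fun x y ⟨k, hx, hy⟩ => h x y ?_⟩
    exact Option.some.inj (hx.trans hy.symm)

theorem closed_ker_graph {A B : Type} (f : A → B) (U : A → Prop) (V : B → Prop) :
    (ker (Sum.elim (fun a => some (f a)) some)).Closed (Sum.elim U V) ↔ U = V ∘ f := by
  have e : (Sum.elim (fun a => some (f a)) some : A ⊕ B → Option B) =
      fun x => some (Sum.elim f id x) := by funext x; cases x <;> rfl
  rw [e, closed_ker]
  constructor
  · exact fun h => funext fun a => propext
      ⟨h (Sum.inl a) (Sum.inr (f a)) rfl, h (Sum.inr (f a)) (Sum.inl a) rfl⟩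
  · rintro rfl x y hxy hx
    have key : ∀ x, Sum.elim (V ∘ f) V x ↔ V (Sum.elim f id x) := by rintro (x | x) <;> rfl
    rw [key] at hx ⊢
    rwa [← hxy]

theorem closed_comp (e : PERel (A ⊕ Z)) (e' : PERel (Z ⊕ B)) (U : A → Prop) (V : B → Prop) :
    (e.comp e').Closed (Sum.elim U V) ↔
      ∃ T : Z → Prop, e.Closed (Sum.elim U T) ∧ e'.Closed (Sum.elim T V) := by
  constructor
  · intro h
    let good : A ⊕ (Z ⊕ B) → Prop := fun w =>
      ∃ u, Sum.elim U V u ∧ Glue e e' (Sum.map id Sum.inr u) w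
    have g0 : ∀ u, good (Sum.map id Sum.inr u) ↔ Sum.elim U V u := fun u =>
      ⟨fun ⟨u', hu', hg⟩ => h.2 u' u ⟨hg, (h.1 u' hu').2⟩ hu', fun hu => ⟨u, hu, (h.1 u hu).1⟩⟩
    have gz : ∀ z, good (Sum.inr (Sum.inl z)) →
        e.rel (Sum.inr z) (Sum.inr z) ∧ e'.rel (Sum.inl z) (Sum.inl z) :=
      fun z ⟨u, hu, hg⟩ => (h.1 u hu).2 z hg
    have gs : ∀ u v, Step e e' u v → good u → good v := fun u v hs ⟨w, hw, hg⟩ =>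
      ⟨w, hw, hg.tail hs⟩
    have gl : ∀ w, good w → ∃ v, Step e e' w v := by
      rintro w ⟨u, hu, hg⟩
      obtain ⟨v, hv, _⟩ := Relation.TransGen.head'_iff.1 hg.symm
      exact ⟨v, hv⟩
    refine ⟨fun z => good (Sum.inr (Sum.inl z)), ?_, ?_⟩
    · have key : ∀ x, Sum.elim U (fun z => good (Sum.inr (Sum.inl z))) x ↔
          good (Sum.map id Sum.inl x) := by
        rintro (x | z)
        · exact (g0 (Sum.inl x)).symm
        · exact Iff.rfl
      refine ⟨fun x hx => ?_, fun x y hxy hx => ?_⟩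
      · rw [key] at hx
        rcases x with x | z
        · obtain ⟨v, ⟨x', y, hr, hx', _⟩ | ⟨x', y, _, hx', _⟩⟩ := gl _ hx
          · rcases x' with x' | z'
            · cases hx'; exact e.refl_left hr
            · cases hx'
          · cases hx'
        · exact (gz z hx).1
      · rw [key] at hx ⊢
        exact gs _ _ (Or.inl ⟨x, y, hxy, rfl, rfl⟩) hx
    · have key : ∀ x, Sum.elim (fun z => good (Sum.inr (Sum.inl z))) V x ↔ good (Sum.inr x) := by
        rintro (z | y)
        · exact Iff.rfl
        · exact (g0 (Sum.inr y)).symm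
      refine ⟨fun x hx => ?_, fun x y hxy hx => ?_⟩
      · rw [key] at hx
        rcases x with z | x
        · exact (gz z hx).2
        · obtain ⟨v, ⟨x', y, _, hx', _⟩ | ⟨x', y, hr, hx', _⟩⟩ := gl _ hx
          · rcases x' with x' | z' <;> cases hx'
          · cases hx'; exact e'.refl_left hr
      · rw [key] at hx ⊢
        exact gs _ _ (Or.inr ⟨x, y, hxy, rfl, rfl⟩) hx
  · rintro ⟨T, h, h'⟩
    let W : A ⊕ (Z ⊕ B) → Prop := Sum.elim U (Sum.elim T V)
    have w0 : ∀ u, W (Sum.map id Sum.inr u) ↔ Sum.elim U V u := by rintro (u | u) <;> rfl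
    have w1 : ∀ u, W (Sum.map id Sum.inl u) ↔ Sum.elim U T u := by rintro (u | u) <;> rfl
    have ws : ∀ u v, Step e e' u v → W u → W v := by
      rintro u v (⟨x, y, hr, rfl, rfl⟩ | ⟨x, y, hr, rfl, rfl⟩)
      · rw [w1, w1]; exact h.2 x y hr
      · exact h'.2 x y hr
    have wg : ∀ u v, Glue e e' u v → W u → W v := by
      intro u v hg hu
      induction hg with
      | single hs => exact ws _ _ hs hu
      | tail _ hs ih => exact ws _ _ hs ih
    refine ⟨fun u hu => ⟨?_, fun z hz => ?_⟩, fun u v hr hu => ?_⟩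
    · rcases u with u | u
      · exact .single (Or.inl ⟨Sum.inl u, Sum.inl u, h.1 (Sum.inl u) hu, rfl, rfl⟩)
      · exact .single (Or.inr ⟨Sum.inr u, Sum.inr u, h'.1 (Sum.inr u) hu, rfl, rfl⟩)
    · have hz' : T z := wg _ _ hz ((w0 u).2 hu)
      exact ⟨h.1 (Sum.inr z) hz', h'.1 (Sum.inl z) hz'⟩
    · exact (w0 v).1 (wg _ _ hr.1 ((w0 u).2 hu))

theorem closed_tensor {a b c d : ℕ} (e : PERel (Fin a ⊕ Fin b)) (e' : PERel (Fin c ⊕ Fin d))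
    (W : Fin (a + c) ⊕ Fin (b + d) → Prop) :
    (e.tensor e').Closed W ↔ e.Closed (W ∘ Sum.map (Fin.castAdd c) (Fin.castAdd d)) ∧
      e'.Closed (W ∘ Sum.map (Fin.natAdd a) (Fin.natAdd b)) := by
  have disj : ∀ (x : Fin a ⊕ Fin b) (y : Fin c ⊕ Fin d),
      Sum.map (Fin.castAdd c) (Fin.castAdd d) x ≠ Sum.map (Fin.natAdd a) (Fin.natAdd b) y := by
    rintro (x | x) (y | y) h <;> simp [Fin.ext_iff] at h <;> have := x.isLt <;> omega
  have i1 : Function.Injective (Sum.map (Fin.castAdd (m := c) (n := a))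
      (Fin.castAdd (m := d) (n := b))) :=
    Function.Injective.sumMap (Fin.castAdd_injective _ _) (Fin.castAdd_injective _ _)
  have i2 : Function.Injective (Sum.map (Fin.natAdd (n := a) (m := c))
      (Fin.natAdd (n := b) (m := d))) :=
    Function.Injective.sumMap (Fin.natAdd_injective _ _) (Fin.natAdd_injective _ _)
  constructor
  · refine fun h => ⟨⟨fun x hx => ?_, fun x y hxy hx => ?_⟩, ⟨fun x hx => ?_, fun x y hxy hx => ?_⟩⟩
    · rcases h.1 _ hx with ⟨x', y', hr, hx', hy'⟩ | ⟨x', y', hr, hx', hy'⟩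
      · cases i1 hx'; exact e.refl_left hr
      · exact absurd hx'.symm (disj _ _)
    · exact h.2 _ _ (Or.inl ⟨x, y, hxy, rfl, rfl⟩) hx
    · rcases h.1 _ hx with ⟨x', y', hr, hx', hy'⟩ | ⟨x', y', hr, hx', hy'⟩
      · exact absurd hx' (disj _ _)
      · cases i2 hx'; exact e'.refl_left hr
    · exact h.2 _ _ (Or.inr ⟨x, y, hxy, rfl, rfl⟩) hx
  · rintro ⟨h, h'⟩
    refine ⟨fun u hu => ?_, ?_⟩
    · have cover : (∃ x, Sum.map (Fin.castAdd c) (Fin.castAdd d) x = u) ∨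
          ∃ x, Sum.map (Fin.natAdd a) (Fin.natAdd b) x = u := by
        rcases u with u | u
        · exact PROP.fin_cases_add (motive := fun u => (∃ x, Sum.map (Fin.castAdd c) (Fin.castAdd d) x
            = Sum.inl u) ∨ ∃ x, Sum.map (Fin.natAdd a) (Fin.natAdd b) x = Sum.inl u) u
            (fun u => Or.inl ⟨Sum.inl u, rfl⟩) (fun u => Or.inr ⟨Sum.inl u, rfl⟩)
        · exact PROP.fin_cases_add (motive := fun u => (∃ x, Sum.map (Fin.castAdd c) (Fin.castAdd d) x
            = Sum.inr u) ∨ ∃ x, Sum.map (Fin.natAdd a) (Fin.natAdd b) x = Sum.inr u) u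
            (fun u => Or.inl ⟨Sum.inr u, rfl⟩) (fun u => Or.inr ⟨Sum.inr u, rfl⟩)
      rcases cover with ⟨x, rfl⟩ | ⟨x, rfl⟩
      · exact Or.inl ⟨x, x, h.1 x hu, rfl, rfl⟩
      · exact Or.inr ⟨x, x, h'.1 x hu, rfl, rfl⟩
    · rintro u v (⟨x, y, hr, rfl, rfl⟩ | ⟨x, y, hr, rfl, rfl⟩) hu
      · exact h.2 x y hr hu
      · exact h'.2 x y hr hu

end PERel

namespace PROP

/-- The graph of the inverse image map of a function. -/
def powGraph {a b : ℕ} (f : Fin b → Fin a) : (Fin a → Prop) → (Fin b → Prop) → Prop :=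
  fun U V => V = U ∘ f

/-- Composition of relations between powersets. -/
def powComp {a b c : ℕ} (R : (Fin a → Prop) → (Fin b → Prop) → Prop)
    (S : (Fin b → Prop) → (Fin c → Prop) → Prop) : (Fin a → Prop) → (Fin c → Prop) → Prop :=
  fun U V => ∃ T, R U T ∧ S T V

/-- Monoidal product of relations between powersets. -/
def powTensor {a b c d : ℕ} (R : (Fin a → Prop) → (Fin b → Prop) → Prop)
    (S : (Fin c → Prop) → (Fin d → Prop) → Prop) :
    (Fin (a + c) → Prop) → (Fin (b + d) → Prop) → Prop :=
  fun U V => R (U ∘ Fin.castAdd c) (V ∘ Fin.castAdd d) ∧ S (U ∘ Fin.natAdd a) (V ∘ Fin.natAdd b)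

theorem eqArrow_pow {a b : ℕ} (h : a = b) :
    eqArrow (H := fun a b => (Fin a → Prop) → (Fin b → Prop) → Prop) (fun _ => powGraph _root_.id) h
      = powGraph (Fin.cast h.symm) := by
  cases h; rfl

theorem ext_split {a b : ℕ} {U V : Fin (a + b) → Prop}
    (h : U ∘ Fin.castAdd b = V ∘ Fin.castAdd b) (h' : U ∘ Fin.natAdd a = V ∘ Fin.natAdd a) :
    U = V := by
  funext i; exact fin_cases_add i (congrFun h) (congrFun h')

theorem powComp_graph {a b c : ℕ} (f : Fin b → Fin a) (g : Fin c → Fin b) :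
    powComp (powGraph f) (powGraph g) = powGraph (f ∘ g) := by
  funext U V; simp [powComp, powGraph, Function.comp_assoc]

theorem powComp_graph_left {a b c : ℕ} (f : Fin b → Fin a)
    (S : (Fin b → Prop) → (Fin c → Prop) → Prop) :
    powComp (powGraph f) S = fun U V => S (U ∘ f) V := by
  funext U V; simp [powComp, powGraph]

theorem powComp_graph_right {a b c : ℕ} (R : (Fin a → Prop) → (Fin b → Prop) → Prop)
    (g : Fin c → Fin b) (g' : Fin b → Fin c) (h : ∀ x, g (g' x) = x) (h' : ∀ x, g' (g x) = x) :
    powComp R (powGraph g) = fun U V => R U (V ∘ g') := by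
  funext U V
  refine propext ⟨?_, fun hR => ⟨_, hR, funext fun x => congrArg V (h' x).symm⟩⟩
  rintro ⟨T, hT, rfl⟩
  convert hT using 1
  exact funext fun x => congrArg T (h x)

theorem powTensor_graph {a b c d : ℕ} (f : Fin b → Fin a) (g : Fin d → Fin c) :
    powTensor (powGraph f) (powGraph g) =
      powGraph (Fin.addCases (fun i => Fin.castAdd c (f i)) (fun i => Fin.natAdd a (g i))) := by
  funext U V
  refine propext ⟨fun ⟨h, h'⟩ => ext_split ?_ ?_, fun h => ?_⟩
  · rw [h]; funext i; simp
  · rw [h']; funext i; simp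
  · cases h
    exact ⟨by funext i; simp, by funext i; simp⟩

theorem swapFin_swapFin (a b : ℕ) (i : Fin (a + b)) : swapFin b a (swapFin a b i) = i := by
  refine fin_cases_add i (fun i => ?_) (fun i => ?_) <;> simp

/-- The auxiliary prop of relations between powersets. -/
def PowRel : PROP where
  Hom a b := (Fin a → Prop) → (Fin b → Prop) → Prop
  id _ := powGraph _root_.id
  comp := powComp
  id_comp R := powComp_graph_left _ R
  comp_id R := powComp_graph_right R _root_.id _root_.id (fun _ => rfl) (fun _ => rfl)
  assoc R S T := by
    funext U V
    exact propext ⟨fun ⟨X, ⟨Y, h, h'⟩, h''⟩ => ⟨Y, h, X, h', h''⟩,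
      fun ⟨Y, h, X, h', h''⟩ => ⟨X, ⟨Y, h, h'⟩, h''⟩⟩
  tensor := powTensor
  tensor_id a b := by
    rw [powTensor_graph]
    congr 1
    funext i
    refine fin_cases_add i (fun i => ?_) (fun i => ?_) <;> simp
  tensor_comp {a b c a' b' c'} R S R' S' := by
    funext U V
    refine propext ⟨?_, ?_⟩
    · rintro ⟨⟨T, h1, h2⟩, ⟨T', h3, h4⟩⟩
      refine ⟨Fin.addCases T T', ⟨?_, ?_⟩, ⟨?_, ?_⟩⟩
      · convert h1; funext i; simp
      · convert h3; funext i; simp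
      · convert h2; funext i; simp
      · convert h4; funext i; simp
    · rintro ⟨T, ⟨h1, h3⟩, ⟨h2, h4⟩⟩
      exact ⟨⟨_, h1, h2⟩, ⟨_, h3, h4⟩⟩
  tensor_assoc {a b a' b' a'' b''} R S T := by
    simp only [eqArrow_pow]
    rw [powComp_graph_left, powComp_graph_right _ _ (Fin.cast (Nat.add_assoc b b' b''))
      (fun _ => rfl) (fun _ => rfl)]
    funext U V
    have e1 : (U ∘ Fin.cast (Nat.add_assoc a a' a'').symm) ∘ Fin.natAdd a ∘ Fin.natAdd a' =
        U ∘ Fin.natAdd (a + a') :=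
      funext fun i => congrArg U (Fin.ext (by simp; omega))
    have e2 : (V ∘ Fin.cast (Nat.add_assoc b b' b'')) ∘ Fin.natAdd (b + b') =
        V ∘ Fin.natAdd b ∘ Fin.natAdd b' :=
      funext fun i => congrArg V (Fin.ext (by simp; omega))
    refine propext ⟨fun ⟨⟨h1, h2⟩, h3⟩ => ⟨h1, h2, ?_⟩, fun ⟨h1, h2, h3⟩ => ⟨⟨h1, h2⟩, ?_⟩⟩
    · change T ((U ∘ Fin.cast (Nat.add_assoc a a' a'').symm) ∘ Fin.natAdd a ∘ Fin.natAdd a')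
        (V ∘ Fin.natAdd b ∘ Fin.natAdd b')
      rwa [e1, ← e2]
    · rw [e2, ← e1]; exact h3
  unit_tensor {a b} R := by
    simp only [eqArrow_pow]
    rw [powComp_graph_left, powComp_graph_right _ _ (Fin.cast (Nat.zero_add b))
      (fun _ => rfl) (fun _ => rfl)]
    funext U V
    have e1 : U ∘ Fin.cast (Nat.zero_add a).symm = U ∘ Fin.natAdd 0 :=
      funext fun i => congrArg U (Fin.ext (by simp))
    have e2 : (V ∘ Fin.cast (Nat.zero_add b)) ∘ Fin.natAdd 0 = V :=
      funext fun i => congrArg V (Fin.ext (by simp))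
    simp only [powTensor, e2, e1]
    exact propext ⟨fun h => h.2, fun h => ⟨funext fun i => i.elim0, h⟩⟩
  tensor_unit {a b} R := by
    simp only [eqArrow_pow]
    rw [powComp_graph_left, powComp_graph_right _ (Fin.cast (Nat.add_zero b).symm)
      (Fin.cast (Nat.add_zero b)) (fun _ => rfl) (fun _ => rfl)]
    funext U V
    exact propext ⟨fun h => h.1, fun h => ⟨h, funext fun i => i.elim0⟩⟩
  symm a b := powGraph (swapFin b a)
  symm_natural {a b a' b'} R S := by
    rw [powComp_graph_left, powComp_graph_right _ _ (swapFin b b') (swapFin_swapFin b b')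
      (swapFin_swapFin b' b)]
    funext U V
    have e1 : ∀ {m n : ℕ} (W : Fin (m + n) → Prop), (W ∘ swapFin n m) ∘ Fin.castAdd m =
        W ∘ Fin.natAdd m := fun W => funext fun i => congrArg W (by simp)
    have e2 : ∀ {m n : ℕ} (W : Fin (m + n) → Prop), (W ∘ swapFin n m) ∘ Fin.natAdd n =
        W ∘ Fin.castAdd n := fun W => funext fun i => congrArg W (by simp)
    simp only [powTensor, e1, e2]
    exact propext And.comm
  symm_symm a b := by
    rw [powComp_graph]
    exact congrArg powGraph (funext fun i => swapFin_swapFin a b i)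
  hexagon a b c := by
    simp only [eqArrow_pow, powComp_graph, powTensor_graph]
    congr 1
    funext i
    refine fin_cases_add i (fun i => ?_) (fun i => ?_)
    · have e : Fin.cast (Nat.add_assoc b c a).symm (Fin.castAdd (c + a) i) =
          Fin.castAdd a (Fin.castAdd c i) := by ext; simp
      have e' : Fin.cast (Nat.add_assoc b a c).symm (Fin.castAdd (a + c) i) =
          Fin.castAdd c (Fin.castAdd a i) := by ext; simp
      simp [e, e']; ext; simp
    · refine fin_cases_add i (fun i => ?_) (fun i => ?_)
      · have e : Fin.cast (Nat.add_assoc b c a).symm (Fin.natAdd b (Fin.castAdd a i)) =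
            Fin.castAdd a (Fin.natAdd b i) := by ext; simp
        have e' : Fin.cast (Nat.add_assoc b a c).symm (Fin.natAdd b (Fin.natAdd a i)) =
            Fin.natAdd (b + a) i := by ext; simp [Nat.add_assoc]
        simp [e, e']; ext; simp [Nat.add_assoc]
      · have e : Fin.cast (Nat.add_assoc b c a).symm (Fin.natAdd b (Fin.natAdd c i)) =
            Fin.natAdd (b + c) i := by ext; simp [Nat.add_assoc]
        have e' : Fin.cast (Nat.add_assoc b a c).symm (Fin.natAdd b (Fin.castAdd c i)) =
            Fin.castAdd c (Fin.natAdd b i) := by ext; simp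
        simp [e, e']; ext; simp

/-- The unions of equivalence classes, as a relation between powersets. -/
def powClosed {a b : ℕ} (e : PERel (Fin a ⊕ Fin b)) : (Fin a → Prop) → (Fin b → Prop) → Prop :=
  fun U V => e.Closed (Sum.elim U V)

theorem powClosed_injective {a b : ℕ} (e e' : PERel (Fin a ⊕ Fin b))
    (h : powClosed e = powClosed e') : e = e' :=
  PERel.ext_of_closed fun W => by
    have := congrFun (congrFun h (W ∘ Sum.inl)) (W ∘ Sum.inr)
    rw [powClosed, powClosed, Sum.elim_comp_inl_inr] at this
    exact iff_of_eq this

theorem powClosed_ker {a b : ℕ} (f : Fin a → Fin b) (g : Fin b → Fin a) (h : ∀ i, f (g i) = i)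
    (h' : ∀ i, g (f i) = i) :
    powClosed (PERel.ker (Sum.elim (fun i => some (f i)) some)) = powGraph g := by
  funext U V
  refine propext ((PERel.closed_ker_graph f U V).trans ⟨?_, ?_⟩)
  · rintro rfl; exact funext fun i => congrArg V (h i).symm
  · rintro rfl; exact funext fun i => congrArg U (h' i).symm

/-- The prop of partial equivalence relations: an arrow `a ⟶ b` is a partial equivalence relation
on the disjoint union of `{0, …, a - 1}` and `{0, …, b - 1}`.  The identities and symmetries are the
partial equivalence relations that identify each element with its image under the identity, or under
the block permutation. -/
def PER : PROP :=
  ofFaithful PowRel (fun a b => PERel (Fin a ⊕ Fin b)) powClosed powClosed_injective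
    (fun a => PERel.ker (Sum.elim (fun i => some i) some : Fin a ⊕ Fin a → Option (Fin a)))
    (fun e e' => e.comp e') (fun e e' => e.tensor e')
    (fun a b => PERel.ker (Sum.elim (fun i => some (swapFin a b i)) some))
    (fun _ => powClosed_ker _root_.id _root_.id (fun _ => rfl) (fun _ => rfl))
    (fun e e' => by
      funext U V
      exact propext (PERel.closed_comp e e' U V))
    (fun e e' => by
      funext U V
      refine propext ((PERel.closed_tensor e e' _).trans ?_)
      rw [Sum.elim_comp_map, Sum.elim_comp_map]; rfl)
    (fun a b => powClosed_ker (swapFin a b) (swapFin b a) (swapFin_swapFin b a)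
      (swapFin_swapFin a b))

/-! ### The legs of the square -/

/-- The morphism from the coproduct of `Inj` and its opposite to cospans of partial functions. -/
noncomputable def toCospanPF : Inj ⨿ Inj.op ⟶ Cospan PF :=
  coprod.desc (injPF ≫ cospanOf PF) (Mor.op injPF ≫ cospanOfOp PF)

/-- The morphism from the coproduct of `Inj` and its opposite to spans of injections. -/
noncomputable def toSpanInj : Inj ⨿ Inj.op ⟶ Span Inj :=
  coprod.desc (spanOf Inj) (spanOfOp Inj)

end PROP

/-!
Fix a family `M` of arrows of `C`.  A morphism out of cospans in `C` modulo `M` is a covariant and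
a contravariant morphism out of `C` that satisfy the Beck–Chevalley condition on pushout squares
and for which every arrow of `M` is a section of its opposite: the composite `f, g ↦ F f ; G g` is
then invariant under `M` and compatible with composition.  Spans are cospans in the opposite prop.
For a morphism `A ⟶ C` and `M` the right class of a costable factorisation system, two facts
therefore make the square of spans, cospans and corelations a pushout.

* The pushout in `C` of the projections of a pullback in `A` maps to the vertex of the pullback by
  an arrow of `M`.  This is the Beck–Chevalley condition for spans, and so provides the morphism
  from spans to corelations.
* The arrows of `M` come from monomorphisms `μ` of `A`.  In spans `μ` is a section of its
  opposite, so a morphism out of cospans that agrees with one out of spans factors through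
  corelations.

For injections in partial functions the comparison arrow of the first fact is split mono.

Corelations of partial functions and partial equivalence relations both embed into relations
between powersets: a cospan relates the inverse images of a single subset along its two legs, and
a partial equivalence relation is determined by its unions of classes.  These are the same
relations.
-/

namespace PROP

section LiftAlongFaithful

variable {P Q R : PROP}

/-- A morphism of props that is injective on arrows. -/
def Mor.Faithful (F : P ⟶ Q) : Prop :=
  ∀ a b, Function.Injective (F.map (a := a) (b := b))

/-- The factorisation of `F` through a faithful morphism `G` whose range contains that of `F`. -/
noncomputable def liftOfFaithful (F : P ⟶ R) (G : Q ⟶ R) (hG : Mor.Faithful G)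
    (h : ∀ a b, Set.range (F.map (a := a) (b := b)) ⊆ Set.range (G.map (a := a) (b := b))) :
    P ⟶ Q :=
  have map_choose {a b : ℕ} (f : P.Hom a b) : G.map (h a b ⟨f, rfl⟩).choose = F.map f :=
    (h a b ⟨f, rfl⟩).choose_spec
  Mor.mk (P := P) (Q := Q) (fun {a b} f => (h a b ⟨f, rfl⟩).choose)
    (fun a => hG a a (by rw [map_choose, F.map_id, G.map_id]))
    (fun {a b c} f g => hG a c
      (by rw [map_choose, F.map_comp, G.map_comp, map_choose, map_choose]))
    (fun {a b c d} f g => hG (a + c) (b + d)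
      (by rw [map_choose, F.map_tensor, G.map_tensor, map_choose, map_choose]))
    (fun a b => hG (a + b) (b + a) (by rw [map_choose, F.map_symm, G.map_symm]))

theorem liftOfFaithful_comp (F : P ⟶ R) (G : Q ⟶ R) (hG : Mor.Faithful G)
    (h : ∀ a b, Set.range (F.map (a := a) (b := b)) ⊆ Set.range (G.map (a := a) (b := b))) :
    liftOfFaithful F G hG h ≫ G = F :=
  hom_ext fun {a b} f => (h a b ⟨f, rfl⟩).choose_spec

theorem Mor.Faithful.cancel_right {F F' : P ⟶ Q} {G : Q ⟶ R} (hG : Mor.Faithful G)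
    (h : F ≫ G = F' ≫ G) : F = F' :=
  hom_ext fun f => hG _ _ (congrArg (fun K : P ⟶ R => K.map f) h)

/-- The isomorphism between two props that embed faithfully into a third one with the same range. -/
noncomputable def isoOfFaithful (F : P ⟶ R) (G : Q ⟶ R)
    (hF : Mor.Faithful F) (hG : Mor.Faithful G)
    (h : ∀ a b, Set.range (F.map (a := a) (b := b)) = Set.range (G.map (a := a) (b := b))) :
    P ≅ Q where
  hom := liftOfFaithful F G hG fun a b => (h a b).subset
  inv := liftOfFaithful G F hF fun a b => (h a b).superset
  hom_inv_id := hF.cancel_right (by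
    rw [Category.assoc, liftOfFaithful_comp, liftOfFaithful_comp, Category.id_comp])
  inv_hom_id := hG.cancel_right (by
    rw [Category.assoc, liftOfFaithful_comp, liftOfFaithful_comp, Category.id_comp])

theorem isoOfFaithful_hom_comp (F : P ⟶ R) (G : Q ⟶ R)
    (hF : Mor.Faithful F) (hG : Mor.Faithful G)
    (h : ∀ a b, Set.range (F.map (a := a) (b := b)) = Set.range (G.map (a := a) (b := b))) :
    (isoOfFaithful F G hF hG h).hom ≫ G = F :=
  liftOfFaithful_comp F G hG fun a b => (h a b).subset

end LiftAlongFaithful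

section BeckChevalley

variable {C X Y : PROP} {F : C ⟶ X} {G : C.op ⟶ X}

/-- The Beck–Chevalley condition for a covariant and a contravariant morphism out of `C`: across
every pushout square in `C`, restricting and then extending agrees with extending and then
restricting.  It makes `F f ; G g` compatible with the composition of cospans. -/
def BeckChevalley (F : C ⟶ X) (G : C.op ⟶ X) : Prop :=
  ∀ ⦃y n m p : ℕ⦄ ⦃f : C.Hom y n⦄ ⦃g : C.Hom y m⦄ ⦃i : C.Hom n p⦄ ⦃j : C.Hom m p⦄,
    IsPushout (C := C.Ob) f g i j →
      X.comp (G.map (a := n) (b := y) f) (F.map g) = X.comp (F.map i) (G.map (a := p) (b := m) j)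

namespace BeckChevalley

theorem postcomp (h : BeckChevalley F G) (K : X ⟶ Y) : BeckChevalley (F ≫ K) (G ≫ K) :=
  fun _ _ _ _ _ _ _ _ sq =>
    (K.map_comp _ _).symm.trans ((congrArg K.map (h sq)).trans (K.map_comp _ _))

theorem comp_of_isIso (h : BeckChevalley F G) {a b : ℕ} (m : C.Hom a b)
    (hm : IsIso (C := C.Ob) (X := a) (Y := b) m) :
    X.comp (F.map m) (G.map (a := b) (b := a) m) = X.id a := by
  have sq : IsPushout (C := C.Ob) (C.id a) (C.id a) m m :=
    have := IsIso.id (C := C.Ob) a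
    IsPushout.of_horiz_isIso (C := C.Ob) ⟨rfl⟩
  rw [← h sq, F.map_id]
  exact (X.comp_id _).trans (G.map_id a)

theorem comp_of_epi (h : BeckChevalley F G) {a b : ℕ} (e : C.Hom a b)
    (he : Epi (C := C.Ob) (X := a) (Y := b) e) :
    X.comp (G.map (a := b) (b := a) e) (F.map e) = X.id b := by
  have sq : IsPushout (C := C.Ob) e e (C.id b) (C.id b) :=
    have := IsIso.id (C := C.Ob) b
    IsPushout.of_horiz_isIso_epi (C := C.Ob) ⟨rfl⟩
  rw [h sq, F.map_id]
  exact (X.id_comp _).trans (G.map_id b)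

end BeckChevalley

end BeckChevalley

section UniversalProperty

variable {C X : PROP} [TensorPushouts C] (M : MorphismProperty C.Ob) [M.ContainsIdentities]
  [M.IsStableUnderCobaseChange] [TensorClosed M]

theorem cmk_eq_comp {a b n : ℕ} (f : C.Hom a n) (g : C.Hom b n) :
    cmk M f g = (cospMod M).comp ((modOf M).map f) ((modOfOp M).map (a := n) (b := b) g) :=
  .symm <| (ccomp_left M f (C.id n) g).trans (by rw [C.comp_id])

theorem beckChevalley_mod : BeckChevalley (modOf M) (modOfOp M) :=
  fun _ n m _ f g i j sq => by
    refine (ccomp_eq M (C.id n) f g (C.id m) sq).trans ?_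
    rw [C.id_comp, C.id_comp]
    exact cmk_eq_comp M i j

variable {M} in
theorem cospMod_map_cmk (H : cospMod M ⟶ X) {a b n : ℕ} (f : C.Hom a n) (g : C.Hom b n) :
    H.map (cmk M f g) =
      X.comp ((modOf M ≫ H).map f) ((modOfOp M ≫ H).map (a := n) (b := b) g) :=
  (congrArg H.map (cmk_eq_comp M f g)).trans (H.map_comp _ _)

variable {M} in
theorem cospMod_hom_ext {H K : cospMod M ⟶ X} (h : modOf M ≫ H = modOf M ≫ K)
    (h' : modOfOp M ≫ H = modOfOp M ≫ K) : H = K := by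
  refine hom_ext ?_
  rintro a b ⟨n, f, g⟩
  exact (cospMod_map_cmk H f g).trans (h ▸ h' ▸ (cospMod_map_cmk K f g).symm)

variable {F : C ⟶ X} {G : C.op ⟶ X}

/-- The universal property of cospans modulo `M`: a pair of morphisms satisfying the
Beck–Chevalley condition, and for which every `m` in `M` is a section of its opposite, extends to
cospans by `f, g ↦ F f ; G g`. -/
def cospModDesc (h : BeckChevalley F G)
    (hM : ∀ ⦃a b : ℕ⦄ (m : C.Hom a b), M (X := a) (Y := b) m →
      X.comp (F.map m) (G.map (a := b) (b := a) m) = X.id a) : cospMod M ⟶ X :=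
  Mor.mk (P := cospMod M) (Q := X)
    (fun {a b} => Quot.lift
      (fun s => X.comp (F.map s.left) (G.map (a := s.apex) (b := b) s.right)) (by
        rintro ⟨n, f, g⟩ ⟨n', f', g'⟩ ⟨(m : C.Hom n n'), hm, hl, hr⟩
        obtain rfl : C.comp f m = f' := hl
        obtain rfl : C.comp g m = g' := hr
        have map_op : G.map (a := n') (b := b) (C.comp g m) =
            X.comp (G.map (a := n') (b := n) m) (G.map (a := n) (b := b) g) := G.map_comp _ _
        change X.comp (F.map f) _ = X.comp (F.map (C.comp f m)) _
        rw [F.map_comp, map_op, X.assoc, ← X.assoc (F.map m), hM m hm, X.id_comp]))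
    (fun a => (congrArg₂ X.comp (F.map_id a) (G.map_id a)).trans (X.id_comp _))
    (by
      rintro a b c ⟨n, f, g⟩ ⟨n', f', g'⟩
      obtain ⟨p, i, j, sq⟩ := exists_pushout g f'
      refine (congrArg _ (ccomp_eq M f g f' g' sq)).trans ?_
      have map_op : G.map (a := p) (b := c) (C.comp g' j) =
          X.comp (G.map (a := p) (b := n') j) (G.map (a := n') (b := c) g') := G.map_comp _ _
      change X.comp (F.map (C.comp f i)) _ = X.comp (X.comp (F.map f) _) (X.comp (F.map f') _)
      rw [F.map_comp, map_op, X.assoc, ← X.assoc (F.map i), ← h sq]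
      simp only [X.assoc])
    (by
      rintro a b c d ⟨n, f, g⟩ ⟨n', f', g'⟩
      exact (congrArg₂ X.comp (F.map_tensor f f') (G.map_tensor g g')).trans
        (X.tensor_comp _ _ _ _).symm)
    (fun a b => (congrArg₂ X.comp (F.map_symm a b) (G.map_id (b + a))).trans (X.comp_id _))

theorem modOf_cospModDesc (h : BeckChevalley F G)
    (hM : ∀ ⦃a b : ℕ⦄ (m : C.Hom a b), M (X := a) (Y := b) m →
      X.comp (F.map m) (G.map (a := b) (b := a) m) = X.id a) :
    modOf M ≫ cospModDesc M h hM = F :=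
  hom_ext fun f => (congrArg (X.comp (F.map f)) (G.map_id _)).trans (X.comp_id _)

theorem modOfOp_cospModDesc (h : BeckChevalley F G)
    (hM : ∀ ⦃a b : ℕ⦄ (m : C.Hom a b), M (X := a) (Y := b) m →
      X.comp (F.map m) (G.map (a := b) (b := a) m) = X.id a) :
    modOfOp M ≫ cospModDesc M h hM = G :=
  hom_ext fun {a b} g =>
    (congrArg (fun u => X.comp u (G.map (a := a) (b := b) g)) (F.map_id _)).trans (X.id_comp _)

end UniversalProperty

section Comparison

variable {A C X : PROP}

/-- The pushout in `C` of the projections of a pullback in `A` maps to the vertex of the pullback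
by an arrow of `M`.  Pullbacks in `A` are written as pushouts in `A.op`. -/
def PullbackComparison (ι : A ⟶ C) (M : MorphismProperty C.Ob) : Prop :=
  ∀ ⦃y n m p q : ℕ⦄ ⦃f : A.Hom n y⦄ ⦃g : A.Hom m y⦄ ⦃i : A.Hom p n⦄ ⦃j : A.Hom p m⦄
    ⦃u : C.Hom n q⦄ ⦃v : C.Hom m q⦄ ⦃k : C.Hom q y⦄,
    IsPushout (C := A.op.Ob) (Z := y) (X := n) (Y := m) (P := p) f g i j →
    IsPushout (C := C.Ob) (ι.map i) (ι.map j) u v →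
    C.comp u k = ι.map f → C.comp v k = ι.map g → M (X := q) (Y := y) k

/-- Every arrow of `M` is the image of a monomorphism of `A`. -/
def LiftsToMono (ι : A ⟶ C) (M : MorphismProperty C.Ob) : Prop :=
  ∀ ⦃n m : ℕ⦄ (k : C.Hom n m), M (X := n) (Y := m) k →
    ∃ μ : A.Hom n m, Mono (C := A.Ob) (X := n) (Y := m) μ ∧ ι.map μ = k

variable {ι : A ⟶ C} {F : CostableFactorisation C.Ob} [TensorPushouts C] [TensorClosed F.M]

theorem PullbackComparison.beckChevalley (h : PullbackComparison ι F.M) :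
    BeckChevalley (C := A.op) (X := Corel C F) (Mor.op ι ≫ modOfOp F.M) (ι ≫ modOf F.M) := by
  rintro y n m p (f : A.Hom n y) (g : A.Hom m y) (i : A.Hom p n) (j : A.Hom p m) sq
  obtain ⟨q, u, v, hq⟩ := exists_pushout (ι.map i) (ι.map j)
  have w : C.comp (ι.map i) (ι.map f) = C.comp (ι.map j) (ι.map g) := by
    rw [← ι.map_comp, ← ι.map_comp]
    exact congrArg ι.map sq.w
  obtain ⟨k, hu, hv⟩ := hq.exists_desc (W := y) (ι.map f) (ι.map g) w
  have mk_eq : cmk F.M (ι.map f) (ι.map g) = cmk F.M u v :=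
    (cmk_sound k (h sq hq hu hv) hu hv).symm
  exact (cmk_eq_comp F.M _ _).symm.trans
    (mk_eq.trans ((cmk_eq_comp F.M u v).trans (beckChevalley_mod F.M hq).symm))

variable [TensorPushouts A.op]

theorem spanOf_comp_spanOfOp_of_mono {n m : ℕ} (μ : A.Hom n m)
    (hμ : Mono (C := A.Ob) (X := n) (Y := m) μ) :
    (Span A).comp ((spanOf A).map μ) ((spanOfOp A).map (a := m) (b := n) μ) = (Span A).id n :=
  have : Epi (C := A.op.Ob) (X := m) (Y := n) μ := ⟨fun u v e => hμ.right_cancellation u v e⟩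
  (beckChevalley_mod (C := A.op) (MorphismProperty.isomorphisms A.op.Ob)).comp_of_epi μ this

theorem LiftsToMono.map_comp_map_op {M : MorphismProperty C.Ob}
    (hM : LiftsToMono ι M) {S : Span A ⟶ X} {T : Cospan C ⟶ X}
    (hS : spanOf A ≫ S = ι ≫ cospanOf C ≫ T)
    (hS' : spanOfOp A ≫ S = Mor.op ι ≫ cospanOfOp C ≫ T) {n m : ℕ} (k : C.Hom n m)
    (hk : M (X := n) (Y := m) k) :
    X.comp ((cospanOf C ≫ T).map k) ((cospanOfOp C ≫ T).map (a := m) (b := n) k) = X.id n := by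
  obtain ⟨μ, hμ, rfl⟩ := hM k hk
  have e : (cospanOf C ≫ T).map (ι.map μ) = S.map ((spanOf A).map μ) :=
    congrArg (fun K : A ⟶ X => K.map μ) hS.symm
  have e' : (cospanOfOp C ≫ T).map (a := m) (b := n) (ι.map μ) =
      S.map ((spanOfOp A).map (a := m) (b := n) μ) :=
    congrArg (fun K : A.op ⟶ X => K.map (a := m) (b := n) μ) hS'.symm
  rw [e, e']
  exact (S.map_comp _ _).symm.trans
    ((congrArg S.map (spanOf_comp_spanOfOp_of_mono μ hμ)).trans (S.map_id n))

theorem desc_comp_eq_desc_comp_iff {S : Span A ⟶ X} {T : Cospan C ⟶ X} :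
    coprod.desc (spanOf A) (spanOfOp A) ≫ S =
        coprod.desc (ι ≫ cospanOf C) (Mor.op ι ≫ cospanOfOp C) ≫ T ↔
      spanOf A ≫ S = ι ≫ cospanOf C ≫ T ∧ spanOfOp A ≫ S = Mor.op ι ≫ cospanOfOp C ≫ T := by
  rw [coprod.hom_ext_iff]
  simp only [coprod.inl_desc_assoc, coprod.inr_desc_assoc, Category.assoc]

/-- The morphism of props sending a span in `A` to the corelation represented by its pushout
in `C`. -/
noncomputable def spanToCorel (h : PullbackComparison ι F.M) : Span A ⟶ Corel C F :=
  cospModDesc (C := A.op) _ h.beckChevalley fun _ _ m hm => h.beckChevalley.comp_of_isIso m hm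

theorem spanToCorel_mk (h : PullbackComparison ι F.M) {a b n p : ℕ} {f : A.Hom n a}
    {g : A.Hom n b} {i : C.Hom a p} {j : C.Hom b p}
    (sq : IsPushout (C := C.Ob) (ι.map f) (ι.map g) i j) :
    (spanToCorel h).map (Span.mk f g) = Corel.mk F i j :=
  (beckChevalley_mod F.M sq).trans (cmk_eq_comp F.M i j).symm

theorem spanOf_spanToCorel (h : PullbackComparison ι F.M) :
    spanOf A ≫ spanToCorel h = ι ≫ cospanOf C ≫ toCorel C F :=
  modOfOp_cospModDesc (C := A.op) _ _ _

theorem spanOfOp_spanToCorel (h : PullbackComparison ι F.M) :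
    spanOfOp A ≫ spanToCorel h = Mor.op ι ≫ cospanOfOp C ≫ toCorel C F :=
  modOf_cospModDesc (C := A.op) _ _ _

theorem isPushout_spanToCorel (h : PullbackComparison ι F.M) (hM : LiftsToMono ι F.M) :
    IsPushout (coprod.desc (spanOf A) (spanOfOp A))
      (coprod.desc (ι ≫ cospanOf C) (Mor.op ι ≫ cospanOfOp C)) (spanToCorel h)
      (toCorel C F) := by
  refine IsPushout.mk' (desc_comp_eq_desc_comp_iff.2
    ⟨spanOf_spanToCorel h, spanOfOp_spanToCorel h⟩) (fun X H K _ e => ?_) fun X S T e => ?_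
  · exact cospMod_hom_ext (congrArg (cospanOf C ≫ ·) e) (congrArg (cospanOfOp C ≫ ·) e)
  · obtain ⟨hS, hS'⟩ := desc_comp_eq_desc_comp_iff.1 e
    have hBC := (beckChevalley_mod (MorphismProperty.isomorphisms C.Ob)).postcomp T
    have hid := fun {a b} k hk => hM.map_comp_map_op (n := a) (m := b) hS hS' k hk
    let H : Corel C F ⟶ X := cospModDesc F.M hBC @hid
    have hH : toCorel C F ≫ H = T :=
      cospMod_hom_ext (modOf_cospModDesc F.M hBC @hid) (modOfOp_cospModDesc F.M hBC @hid)
    refine ⟨H, cospMod_hom_ext ?_ ?_, hH⟩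
    · exact (spanOfOp_spanToCorel h =≫ H).trans
        ((congrArg (fun K => Mor.op ι ≫ cospanOfOp C ≫ K) hH).trans hS'.symm)
    · exact (spanOf_spanToCorel h =≫ H).trans
        ((congrArg (fun K => ι ≫ cospanOf C ≫ K) hH).trans hS.symm)

end Comparison

theorem injPF_liftsToMono : LiftsToMono injPF PFfact.M := by
  rintro n m k ⟨μ, hμ⟩
  refine ⟨μ, ⟨fun {z} (u : Fin z ↪ Fin n) (v : Fin z ↪ Fin n) e => ?_⟩, (funext hμ).symm⟩
  have w : u.trans μ = v.trans μ := e
  exact Function.Embedding.ext fun x => μ.injective (DFunLike.congr_fun w x)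

theorem exists_amalgamation {X Y Z W : Type*} [Nonempty W] {f : X → Z} {g : Y → Z}
    (hf : Function.Injective f) (hg : Function.Injective g) {u : X → W} {v : Y → W}
    (h : ∀ x y, f x = g y → u x = v y) : ∃ r : Z → W, r ∘ f = u ∧ r ∘ g = v := by
  have factors : (Sum.elim u v).FactorsThrough (Sum.elim f g) := by
    rintro (x | x) (y | y) e
    · exact congrArg u (hf e)
    · exact h x y e
    · exact (h y x e.symm).symm
    · exact congrArg v (hg e)
  obtain ⟨r, hr⟩ := (Function.factorsThrough_iff _).1 factors
  exact ⟨r, funext fun x => (congrFun hr (Sum.inl x)).symm,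
    funext fun y => (congrFun hr (Sum.inr y)).symm⟩

-- The comparison arrow has a retraction, because the two legs of the pushout agree where the
-- injections meet and so amalgamate to a partial function on their common codomain.
theorem injPF_pullbackComparison : PullbackComparison injPF PFfact.M := by
  rintro y n m p q (f : Fin n ↪ Fin y) (g : Fin m ↪ Fin y) (i : Fin p ↪ Fin n) (j : Fin p ↪ Fin m)
    u v k sq hq hu hv
  obtain ⟨-, meet⟩ := (Inj.isPushout_op_iff f g i j).1 sq
  have agree : ∀ x x', f x = g x' → u x = v x' := by
    intro x x' e
    obtain ⟨z, rfl, rfl⟩ := meet x x' e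
    exact congrFun hq.w z
  obtain ⟨r, hru, hrv⟩ := exists_amalgamation f.injective g.injective agree
  have retract : PF.comp k r = PF.id q := by
    refine hq.hom_ext ?_ ?_
    · exact (PF.assoc u k r).symm.trans
        ((congrArg (PF.comp · r) hu).trans (hru.trans (PF.comp_id u).symm))
    · exact (PF.assoc v k r).symm.trans
        ((congrArg (PF.comp · r) hv).trans (hrv.trans (PF.comp_id v).symm))
  exact isInj_of_retract retract

section Preim

variable {X X' Y Z : Type*}

/-- The inverse image of a subset along a partial function. -/
def preim (f : X → Option Y) (W : Y → Prop) : X → Prop :=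
  fun x => ∃ k, f x = some k ∧ W k

theorem preim_some_comp (f : X → Y) (W : Y → Prop) : preim (fun x => some (f x)) W = W ∘ f := by
  funext x
  simp [preim]

theorem eq_preim_some_comp_equiv_iff (e : X ≃ Y) (U : X → Prop) (V : Y → Prop) :
    U = preim (fun x => some (e x)) V ↔ V = U ∘ e.symm := by
  rw [preim_some_comp, Equiv.eq_comp_symm, eq_comm]

theorem preim_bind (f : X → Option Y) (g : Y → Option Z) (W : Z → Prop) :
    preim (fun x => (f x).bind g) W = preim f (preim g W) := by
  funext x
  cases h : f x <;> simp [preim, h]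

theorem preim_map (f : X → Option Y) (μ : Y → Z) (W : Z → Prop) :
    preim (fun x => (f x).map μ) W = preim f (W ∘ μ) := by
  funext x
  cases h : f x <;> simp [preim, h]

theorem preim_sumElim (f : X → Option Y) (g : X' → Option Y) (W : Y → Prop) :
    preim (Sum.elim f g) W = Sum.elim (preim f W) (preim g W) := by
  funext x
  cases x <;> rfl

theorem eq_preim_pfTensor_iff {a b c d : ℕ} (f : Fin a → Option (Fin b))
    (g : Fin c → Option (Fin d)) (U : Fin (a + c) → Prop) (V : Fin (b + d) → Prop) :
    U = preim (pfTensor f g) V ↔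
      U ∘ Fin.castAdd c = preim f (V ∘ Fin.castAdd d) ∧
        U ∘ Fin.natAdd a = preim g (V ∘ Fin.natAdd b) := by
  have left : preim (pfTensor f g) V ∘ Fin.castAdd c = preim f (V ∘ Fin.castAdd d) := by
    rw [← preim_map]
    funext x
    simp only [Function.comp_apply, preim, pfTensor_castAdd]
  have right : preim (pfTensor f g) V ∘ Fin.natAdd a = preim g (V ∘ Fin.natAdd b) := by
    rw [← preim_map]
    funext x
    simp only [Function.comp_apply, preim, pfTensor_natAdd]
  rw [← left, ← right]
  exact ⟨fun h => h ▸ ⟨rfl, rfl⟩, fun h => ext_split h.1 h.2⟩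

/-- The domain of definition of a partial function. -/
def domain (f : X → Option Y) : X → Prop :=
  preim f fun _ => True

theorem domain_bind (f : X → Option Y) (g : Y → Option Z) :
    domain (fun x => (f x).bind g) = preim f (domain g) :=
  preim_bind f g _

theorem domain_injective [Subsingleton Y] :
    Function.Injective (domain : (X → Option Y) → X → Prop) := by
  intro f g h
  funext x
  refine Option.ext fun k => ?_
  have exists_iff (o : Option Y) : (∃ l, o = some l ∧ True) ↔ o = some k :=
    ⟨fun ⟨l, hl, _⟩ => Subsingleton.elim l k ▸ hl, fun hk => ⟨k, hk, trivial⟩⟩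
  exact (exists_iff _).symm.trans ((iff_of_eq (congrFun h x)).trans (exists_iff _))

theorem domain_surjective [Nonempty Y] :
    Function.Surjective (domain : (X → Option Y) → X → Prop) := by
  classical
  intro W
  refine ⟨fun x => if W x then some (Classical.arbitrary Y) else none, funext fun x => ?_⟩
  by_cases h : W x <;> simp [domain, preim, h]

end Preim

-- A subset of `Fin n` is the domain of a unique arrow `n ⟶ 1`, so this is the universal property of
-- the pushout tested on the object `1`.
theorem exists_preim_iff_of_isPushout {y n m p : ℕ} {f : PF.Hom y n} {g : PF.Hom y m}
    {i : PF.Hom n p} {j : PF.Hom m p} (sq : IsPushout (C := PF.Ob) f g i j) (U : Fin n → Prop)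
    (V : Fin m → Prop) : (∃ W, U = preim i W ∧ V = preim j W) ↔ preim f U = preim g V := by
  constructor
  · rintro ⟨W, rfl, rfl⟩
    exact (preim_bind f i W).symm.trans ((congrArg (preim · W) sq.w).trans (preim_bind g j W))
  · intro h
    obtain ⟨φ, rfl⟩ := domain_surjective (Y := Fin 1) U
    obtain ⟨ψ, rfl⟩ := domain_surjective (Y := Fin 1) V
    have w : PF.comp f φ = PF.comp g ψ :=
      domain_injective ((domain_bind f φ).trans (h.trans (domain_bind g ψ).symm))
    obtain ⟨χ, hφ, hψ⟩ := sq.exists_desc (W := (1 : ℕ)) φ ψ w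
    exact ⟨domain χ, (congrArg domain hφ).symm.trans (domain_bind i χ),
      (congrArg domain hψ).symm.trans (domain_bind j χ)⟩

/-- The block permutation as an equivalence. -/
def swapEquiv (a b : ℕ) : Fin (a + b) ≃ Fin (b + a) :=
  ⟨swapFin a b, swapFin b a, swapFin_swapFin a b, swapFin_swapFin b a⟩

/-- The morphism sending a partial function to the relation between a subset of its codomain and
the inverse image of that subset. -/
def preimRel : PF ⟶ PowRel :=
  Mor.mk (P := PF) (Q := PowRel) (fun f U V => U = preim f V)
    (fun a => funext fun U => funext fun V =>
      propext (eq_preim_some_comp_equiv_iff (Equiv.refl (Fin a)) U V))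
    (fun f g => funext fun U => funext fun V => propext
      ((iff_of_eq (congrArg (U = ·) (preim_bind f g V))).trans
        ⟨fun h => ⟨_, h, rfl⟩, fun ⟨_, h, h'⟩ => h' ▸ h⟩))
    (fun f g => funext fun U => funext fun V => propext (eq_preim_pfTensor_iff f g U V))
    (fun a b => funext fun U => funext fun V => propext
      (eq_preim_some_comp_equiv_iff (swapEquiv a b) U V))

/-- The morphism sending a relation between powersets to its converse. -/
def powConverse : PowRel.op ⟶ PowRel :=
  Mor.mk (P := PowRel.op) (Q := PowRel) (fun R U V => R V U)
    (fun _ => funext fun _ => funext fun _ => propext eq_comm)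
    (fun _ _ => funext fun _ => funext fun _ => propext
      ⟨fun ⟨T, h, h'⟩ => ⟨T, h', h⟩, fun ⟨T, h, h'⟩ => ⟨T, h', h⟩⟩)
    (fun _ _ => rfl)
    (fun a b => funext fun U => funext fun V => propext
      (eq_comm.trans (Equiv.eq_comp_symm (swapEquiv a b) V U).symm))

theorem preimRel_beckChevalley : BeckChevalley preimRel (Mor.op preimRel ≫ powConverse) :=
  fun _ _ _ _ _ _ _ _ sq => funext fun U => funext fun V => propext
    (exists_eq_left.trans (exists_preim_iff_of_isPushout sq U V).symm)

theorem preimRel_comp_converse_of_isInj ⦃n m : ℕ⦄ (k : PF.Hom n m)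
    (hk : isInj (X := n) (Y := m) k) :
    PowRel.comp (preimRel.map k)
      ((Mor.op preimRel ≫ powConverse).map (a := m) (b := n) k) = PowRel.id n := by
  obtain ⟨μ, hμ⟩ := hk
  obtain rfl : k = fun x => some (μ x) := funext hμ
  refine funext fun U => funext fun V => propext ⟨?_, ?_⟩
  · rintro ⟨W, hU, hV⟩
    exact hV.trans hU.symm
  · intro h
    obtain ⟨W, hW⟩ := μ.injective.surjective_comp_right U
    have hU : U = preim (fun x => some (μ x)) W := hW.symm.trans (preim_some_comp μ W).symm
    exact ⟨W, hU, Eq.trans h hU⟩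

/-- The corelation represented by a cospan, as the relation between powersets whose members are the
pairs of inverse images of a single subset along the two legs. -/
def corelToPowRel : Corel PF PFfact ⟶ PowRel :=
  cospModDesc PFfact.M preimRel_beckChevalley preimRel_comp_converse_of_isInj

end PROP

namespace PERel

variable {X Y Z : Type}

theorem closed_ker_iff_exists_preim (h : X → Option Y) (P : X → Prop) :
    (ker h).Closed P ↔ ∃ W, P = PROP.preim h W := by
  constructor
  · rintro ⟨hdom, hrel⟩
    refine ⟨fun k => ∃ x, h x = some k ∧ P x, funext fun x => propext ⟨fun hx => ?_, ?_⟩⟩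
    · obtain ⟨k, hk, _⟩ := hdom x hx
      exact ⟨k, hk, x, hk, hx⟩
    · rintro ⟨k, hk, y, hy, hPy⟩
      exact hrel y x ⟨k, hy, hk⟩ hPy
  · rintro ⟨W, rfl⟩
    refine ⟨fun x ⟨k, hk, _⟩ => ⟨k, hk, hk⟩, ?_⟩
    rintro x y ⟨k, hx, hy⟩ ⟨l, hl, hW⟩
    cases hx.symm.trans hl
    exact ⟨k, hy, hW⟩

theorem exists_surjective_ker_eq [Finite X] (e : PERel X) :
    ∃ (n : ℕ) (q : X → Option (Fin n)), (∀ k, ∃ x, q x = some k) ∧ ker q = e := by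
  classical
  let S : Setoid {x // e.rel x x} :=
    ⟨fun x y => e.rel x.1 y.1, fun x => x.2, fun h => e.symm h, fun h h' => e.trans h h'⟩
  obtain ⟨n, ⟨ε⟩⟩ := Finite.exists_equiv_fin (Quotient S)
  let q : X → Option (Fin n) := fun x =>
    if h : e.rel x x then some (ε (Quotient.mk S ⟨x, h⟩)) else none
  have q_eq_some {x : X} (h : e.rel x x) : q x = some (ε (Quotient.mk S ⟨x, h⟩)) := dif_pos h
  have defined {x : X} {k : Fin n} (hk : q x = some k) : e.rel x x := by
    by_contra h
    exact Option.some_ne_none k (hk.symm.trans (dif_neg h))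
  refine ⟨n, q, fun k => ?_, PERel.ext ?_⟩
  · obtain ⟨⟨x, hx⟩, hk⟩ := Quotient.exists_rep (ε.symm k)
    exact ⟨x, (q_eq_some hx).trans (congrArg some (ε.eq_symm_apply.1 hk))⟩
  · refine funext fun x => funext fun y => propext ⟨?_, fun h => ?_⟩
    · rintro ⟨k, hx, hy⟩
      have same_class := (q_eq_some (defined hx)).symm.trans (hx.trans (hy.symm.trans
        (q_eq_some (defined hy))))
      exact Quotient.exact (ε.injective (Option.some.inj same_class))
    · refine ⟨_, q_eq_some (e.refl_left h), (q_eq_some (e.refl_right h)).trans ?_⟩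
      exact congrArg (fun c => some (ε c)) (Quotient.sound (e.symm h))

theorem exists_embedding_of_ker_eq {q : X → Option Y} (hq : ∀ k, ∃ x, q x = some k)
    {h : X → Option Z} (e : ker q = ker h) :
    ∃ μ : Y ↪ Z, (fun x => (q x).bind fun k => some (μ k)) = h := by
  have rel_iff (x y : X) : (∃ k, q x = some k ∧ q y = some k) ↔ ∃ k, h x = some k ∧ h y = some k :=
    iff_of_eq (congrFun (congrFun (congrArg PERel.rel e) x) y)
  choose c hc using hq
  have defined (k : Y) : ∃ l, h (c k) = some l :=
    have ⟨l, hl, _⟩ := (rel_iff (c k) (c k)).1 ⟨k, hc k, hc k⟩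
    ⟨l, hl⟩
  choose μ hμ using defined
  have injective : Function.Injective μ := by
    intro k k' hk
    obtain ⟨l, hl, hl'⟩ := (rel_iff (c k) (c k')).2 ⟨μ k, hμ k, hk ▸ hμ k'⟩
    exact Option.some.inj ((hc k).symm.trans (hl.trans (hl'.symm.trans (hc k'))))
  refine ⟨⟨μ, injective⟩, funext fun x => ?_⟩
  cases hx : q x with
  | some k =>
    obtain ⟨l, hl, hl'⟩ := (rel_iff x (c k)).1 ⟨k, hx, hc k⟩
    exact (hμ k).symm.trans (hl'.trans hl.symm)
  | none =>
    refine (Option.eq_none_iff_forall_ne_some.2 fun l hl => ?_).symm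
    obtain ⟨k, hk, _⟩ := (rel_iff x x).2 ⟨l, hl, hl⟩
    exact Option.some_ne_none k (hk.symm.trans hx)

end PERel

namespace PROP

section PartialEquivalenceRelations

variable {a b n n' : ℕ}

theorem corelToPowRel_mk (f : PF.Hom a n) (g : PF.Hom b n) :
    corelToPowRel.map (Corel.mk PFfact f g) = powClosed (PERel.ker (Sum.elim f g)) := by
  refine funext fun U => funext fun V => propext (Iff.symm ?_)
  refine (PERel.closed_ker_iff_exists_preim (Sum.elim f g) (Sum.elim U V)).trans
    (exists_congr fun W => ?_)
  exact (iff_of_eq (congrArg (Sum.elim U V = ·) (preim_sumElim f g W))).trans Sum.elim_eq_iff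

theorem Corel.mk_eq_of_ker_eq {f : PF.Hom a n} {g : PF.Hom b n} {f' : PF.Hom a n'}
    {g' : PF.Hom b n'} (hs : ∀ k, ∃ x, (Sum.elim f g : _ → Option (Fin n)) x = some k)
    (h : PERel.ker (Sum.elim f g : _ → Option (Fin n)) = PERel.ker (Sum.elim f' g')) :
    Corel.mk PFfact f g = Corel.mk PFfact f' g' := by
  obtain ⟨μ, hμ⟩ := PERel.exists_embedding_of_ker_eq hs h
  exact cmk_sound (M := PFfact.M) (fun k => some (μ k)) ⟨μ, fun _ => rfl⟩
    (funext fun x => congrFun hμ (Sum.inl x)) (funext fun x => congrFun hμ (Sum.inr x))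

theorem exists_surjective_cospan (e : PERel (Fin a ⊕ Fin b)) :
    ∃ (n : ℕ) (f : PF.Hom a n) (g : PF.Hom b n),
      (∀ k, ∃ x, (Sum.elim f g : _ → Option (Fin n)) x = some k) ∧
        PERel.ker (Sum.elim f g : _ → Option (Fin n)) = e := by
  obtain ⟨n, q, hq, rfl⟩ := e.exists_surjective_ker_eq
  refine ⟨n, q ∘ Sum.inl, q ∘ Sum.inr, ?_⟩
  rw [Sum.elim_comp_inl_inr]
  exact ⟨hq, rfl⟩

theorem corelToPowRel_faithful : Mor.Faithful corelToPowRel := by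
  rintro a b ⟨n, f, g⟩ ⟨n', f', g'⟩ h
  have ker_eq : PERel.ker (Sum.elim f g : _ → Option (Fin n)) = PERel.ker (Sum.elim f' g') :=
    powClosed_injective _ _ ((corelToPowRel_mk f g).symm.trans (h.trans (corelToPowRel_mk f' g')))
  obtain ⟨m, u, v, hs, huv⟩ := exists_surjective_cospan (PERel.ker (Sum.elim f g))
  exact (Corel.mk_eq_of_ker_eq hs huv).symm.trans (Corel.mk_eq_of_ker_eq hs (huv.trans ker_eq))

/-- The morphism sending a partial equivalence relation to the relation between powersets given by
its unions of equivalence classes. -/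
def perToPowRel : PER ⟶ PowRel :=
  Mor.mk (P := PER) (Q := PowRel) (fun e => powClosed e)
    (fun _ => powClosed_ker _root_.id _root_.id (fun _ => rfl) (fun _ => rfl))
    (fun e e' => funext fun U => funext fun V => propext (PERel.closed_comp e e' U V))
    (fun e e' => funext fun U => funext fun V => propext ((PERel.closed_tensor e e' _).trans
      (by rw [Sum.elim_comp_map, Sum.elim_comp_map]; rfl)))
    (fun a b => powClosed_ker (swapFin a b) (swapFin b a) (swapFin_swapFin b a)
      (swapFin_swapFin a b))

theorem perToPowRel_faithful : Mor.Faithful perToPowRel :=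
  fun _ _ => powClosed_injective

theorem range_corelToPowRel (a b : ℕ) :
    Set.range (corelToPowRel.map (a := a) (b := b)) =
      Set.range (perToPowRel.map (a := a) (b := b)) := by
  apply Set.Subset.antisymm
  · rintro _ ⟨⟨n, f, g⟩, rfl⟩
    exact ⟨_, (corelToPowRel_mk f g).symm⟩
  · rintro _ ⟨e, rfl⟩
    obtain ⟨n, f, g, -, h⟩ := exists_surjective_cospan e
    exact ⟨Corel.mk PFfact f g, (corelToPowRel_mk f g).trans (congrArg powClosed h)⟩

/-- The isomorphism between corelations of partial functions and partial equivalence relations: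
both embed into relations between powersets, with the same range. -/
noncomputable def corelIsoPER : Corel PF PFfact ≅ PER :=
  isoOfFaithful corelToPowRel perToPowRel corelToPowRel_faithful perToPowRel_faithful
    range_corelToPowRel

theorem corelIsoPER_hom_mk (f : PF.Hom a n) (g : PF.Hom b n) :
    corelIsoPER.hom.map (Corel.mk PFfact f g) = PERel.ker (Sum.elim f g) := by
  refine perToPowRel_faithful _ _ (Eq.trans ?_ (corelToPowRel_mk f g))
  exact congrArg (fun K : Corel PF PFfact ⟶ PowRel => K.map (Corel.mk PFfact f g))
    (isoOfFaithful_hom_comp corelToPowRel perToPowRel corelToPowRel_faithful perToPowRel_faithful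
      range_corelToPowRel)

end PartialEquivalenceRelations

end PROP

theorem mainTheorem10 :
    ∃ (φ : PROP.Corel PROP.PF PROP.PFfact ≅ PROP.PER)
      (Ψ : PROP.Span PROP.Inj ⟶ PROP.Corel PROP.PF PROP.PFfact),
      (∀ (a b n : ℕ) (f : PROP.PF.Hom a n) (g : PROP.PF.Hom b n),
        φ.hom.map (PROP.Corel.mk PROP.PFfact f g) = PERel.ker (Sum.elim f g)) ∧
      (∀ (a b n p : ℕ) (f : PROP.Inj.Hom n a) (g : PROP.Inj.Hom n b)
        (i : PROP.PF.Hom a p) (j : PROP.PF.Hom b p),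
        IsPushout (C := PROP.PF.Ob) (PROP.injPF.map f) (PROP.injPF.map g) i j →
          Ψ.map (PROP.Span.mk f g) = PROP.Corel.mk PROP.PFfact i j) ∧
      IsPushout PROP.toSpanInj PROP.toCospanPF Ψ (PROP.toCorel PROP.PF PROP.PFfact) ∧
      IsPushout PROP.toSpanInj PROP.toCospanPF (Ψ ≫ φ.hom)
        (PROP.toCorel PROP.PF PROP.PFfact ≫ φ.hom) := by
  refine ⟨PROP.corelIsoPER, PROP.spanToCorel PROP.injPF_pullbackComparison,
    fun _ _ _ f g => PROP.corelIsoPER_hom_mk f g,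
    fun _ _ _ _ _ _ _ _ sq => PROP.spanToCorel_mk _ sq, ?_⟩
  have square : IsPushout PROP.toSpanInj PROP.toCospanPF
      (PROP.spanToCorel PROP.injPF_pullbackComparison) (PROP.toCorel PROP.PF PROP.PFfact) :=
    PROP.isPushout_spanToCorel PROP.injPF_pullbackComparison PROP.injPF_liftsToMono
  exact ⟨square, square.of_iso (Iso.refl _) (Iso.refl _) (Iso.refl _) PROP.corelIsoPER
    (by simp) (by simp) (by simp) (by simp)⟩
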